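/- Let $d\ge 1$, and for $i=1,\dots,d$ let $(\Omega_i,\mathcal F^i,\mathbb P_i)$ be a probability space with an increasing sequence $(\mathcal F^i_n)_{n\in\mathbb N}$ of sub-$\sigma$-algebras of $\mathcal F^i$ such that $\mathcal F^i=\sigma\big(\bigcup_n\mathcal F^i_n\big)$. Let $(\Omega,\mathcal F,\mathbb P)$ be the product probability space, let $\mathcal F_n=\sigma(\mathcal F^1_n\times\cdots\times\mathcal F^d_n)$, and let $\mathbb E_n$ be the conditional expectation with respect to $\mathcal F_n$. For $\vec p=(p_1,\dots,p_d)$ let $\|f\|_{\vec p}$ be the mixed norm obtained by taking successively the $L_{p_1}(\mathbb P_1)$-norm of $f$ in $x_1$, the $L_{p_2}(\mathbb P_2)$-norm in $x_2$, …, the $L_{p_d}(\mathbb P_d)$-norm in $x_d$. Say that $\vec p$ satisfies $(*)$ if, for some $k\in\{1,\dots,d\}$, $$\vec p=(1,\dots,1,p_{k+1},\dots,p_d),\qquad 1<p_{k+1},\dots,p_d<\infty. \tag{$*$}$$ (1) Suppose that $1<p_i<\infty$ for all $i$, or that $\vec p$ satisfies $(*)$. Then there is a finite constant $c$, depending only on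 $\vec p$, such that for every sequence $(f_n)_{n\in\mathbb N}$ of non-negative measurable functions on $\Omega$, $$\Big\|\sum_{n\in\mathbb N}\mathbb E_n f_n\Big\|_{\vec p}\le c\,\Big\|\sum_{n\in\mathbb N}f_n\Big\|_{\vec p}.$$ (2) Suppose that $2<p_i<\infty$ for all $i$, or that $\vec p/2=(p_1/2,\dots,p_d/2)$ satisfies $(*)$. Then there is a finite constant $c$, depending only on $\vec p$, such that for every real martingale $f=(f_n)_{n\in\mathbb N}$ with respect to $(\mathcal F_n)$ with $f_0=0$, $$\|f\|_{H^s_{\vec p}}\le c\,\|f\|_{H^S_{\vec p}},$$ where, with $d_0f=0$ and $d_nf=f_n-f_{n-1}$ for $n\ge1$, $$\|f\|_{H^S_{\vec p}}=\Big\|\Big(\sum_{n\ge 0}|d_nf|^2\Big)^{1/2}\Big\|_{\vec p},\qquad \|f\|_{H^s_{\vec p}}=\Big\|\Big(\sum_{n\ge 1}\mathbb E_{n-1}|d_nf|^2\Big)^{1/2}\Big\|_{\vec p}.$$ Both inequalities hold in $[0,\infty]$, and the conditional expectations are those of non-negative functions, with values in $[0,\infty]$. -/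

import Mathlib

open MeasureTheory ProbabilityTheory
open scoped ENNReal NNReal

universe u

noncomputable section

namespace MixedMartingale

/-- The mixed `L_p`-norm `‖f‖_{(p_1, …, p_d)}` of a `[0,∞]`-valued function `f` of `d` variables:
first take the `L_{p_1}`-norm in the first variable, with the other variables fixed, and then the
mixed `L_{(p_2, …, p_d)}`-norm of the resulting function of the remaining variables.
A function of no variables is a number, which is its own norm. -/
def mixedNorm : {d : ℕ} → {Ω : Fin d → Type u} → [(i : Fin d) → MeasurableSpace (Ω i)] →
    ((i : Fin d) → Measure (Ω i)) → (Fin d → ℝ≥0∞) → (((i : Fin d) → Ω i) → ℝ≥0∞) → ℝ≥0∞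
  | 0, _, _, _, _, f => f (fun i => i.elim0)
  | _ + 1, Ω, _, P, p, f =>
      mixedNorm (fun i => P i.succ) (fun i => p i.succ)
        (fun y => eLpNorm (fun x => f (Fin.cons (α := Ω) x y)) (p 0) (P 0))

/-- All coordinates of the exponent vector are finite and strictly greater than `a`. -/
def FiniteAbove {d : ℕ} (a : ℝ≥0∞) (p : Fin d → ℝ≥0∞) : Prop :=
  ∀ i, a < p i ∧ p i < ∞

/-- The exponent vector has the form `(1, …, 1, p_{k+1}, …, p_d)` for some `k ∈ {1, …, d}`, with
`1 < p_{k+1}, …, p_d < ∞` (indices in `Fin d` start from `0`, so `p_j` is `p (j - 1)`). -/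
def LeadingOnes {d : ℕ} (p : Fin d → ℝ≥0∞) : Prop :=
  ∃ k : ℕ, 1 ≤ k ∧ k ≤ d ∧
    ∀ i : Fin d, ((i : ℕ) < k → p i = 1) ∧ (k ≤ (i : ℕ) → 1 < p i ∧ p i < ∞)

/-- The filtration `ℱ_n = σ(ℱ_n^1 × ⋯ × ℱ_n^d)` on the product space. -/
def prodFiltration {d : ℕ} {Ω : Fin d → Type u} [m : (i : Fin d) → MeasurableSpace (Ω i)]
    (ℱ : (i : Fin d) → Filtration ℕ (m i)) :
    Filtration ℕ (MeasurableSpace.pi : MeasurableSpace ((i : Fin d) → Ω i)) where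
  seq n := MeasurableSpace.pi (m := fun i => ℱ i n)
  mono' _ _ h := iSup_mono fun i => MeasurableSpace.comap_mono ((ℱ i).mono h)
  le' n := iSup_mono fun i => MeasurableSpace.comap_mono ((ℱ i).le n)

variable {X : Type u}

/-- Martingale differences `d_n f = f_n - f_{n-1}` for `n ≥ 1`, and `d_0 f = 0`. -/
def mdiff (f : ℕ → X → ℝ) : ℕ → X → ℝ
  | 0 => 0
  | n + 1 => f (n + 1) - f n

/-- The quadratic variation `S(f) = (∑_n |d_n f|²)^{1/2}`. -/
def quadVar (f : ℕ → X → ℝ) (x : X) : ℝ≥0∞ :=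
  (∑' n, ‖mdiff f n x‖ₑ ^ 2) ^ (1 / 2 : ℝ)

/-- The conditional quadratic variation `s(f) = (∑_n E_{n-1} |d_n f|²)^{1/2}`. The term of index
`0` vanishes because `d_0 f = 0`, so the sum is over `n + 1` with `n ∈ ℕ`. -/
def condQuadVar {m : MeasurableSpace X} (ℱ : Filtration ℕ m) (μ : Measure X)
    (f : ℕ → X → ℝ) (x : X) : ℝ≥0∞ :=
  (∑' n, condLExp (ℱ n) μ (fun y => ‖mdiff f (n + 1) y‖ₑ ^ 2) x) ^ (1 / 2 : ℝ)

end MixedMartingale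

end

noncomputable section

namespace MixedMartingale

/-! ### Conditional expectations of non-negative functions -/

section CondLExp

variable {m₁ m : MeasurableSpace X} {μ : Measure X} [IsProbabilityMeasure μ]

/-! Let N_k be the mixed norm in the first k variables (`partialNorm`), a function of the remaining
ones. The estimate ∫ N_k(∑ E_n f_n)^q ≤ C ∫ N_k(∑ f_n)^q (`SumBound`) is proved for all q > 1 by
induction on k. For k = 0 and q = 1 it is an equality, because conditional expectations preserve
integrals. By Fubini ∫ N_{k+1}(f)^p = ∫ N_k(f)^p when p = p_{k+1}, so the estimate for N_k at this
exponent is the estimate for N_{k+1} at the same exponent. It must then be carried from this single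
exponent to all q > 1, which is `exists_sumBound`, the heart of the proof. For k = d the norm is a
constant and the integral disappears.

The extrapolation only uses that N_k resembles a norm, commutes with multiplication by functions of
the other variables, respects the filtrations and satisfies the conditional Minkowski inequality
N_k(E(f | 𝒢_n)) ≤ E(N_k f | ℋ_n), where ℋ_n is 𝒢_n with the first k coordinates made trivial
(`IsPartialNorm`). The product structure enters through `partialLp_condLExp_le`. To raise the
exponent, the known bound is localised to the tail of the sum after time n, and the Garsia–Neveu and
Doob inequalities conclude. To lower it, the known bound is applied to functions reweighted by a
negative power of a maximal function.

Extrapolation never reaches q = 1. An exponent p_{k+1} = 1 is therefore admissible only if the bound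
at q = 1 has survived so far, that is, if all earlier exponents are 1. The inequality for
martingales is the first one with exponents p/2, applied to the squares |d_{n+1} f|². -/

theorem lintegral_mul_condLExp (h₁ : m₁ ≤ m) {θ f : X → ℝ≥0∞} (hθ : Measurable[m₁] θ)
    (hf : Measurable f) : ∫⁻ x, θ x * condLExp m₁ μ f x ∂μ = ∫⁻ x, θ x * f x ∂μ := by
  -- The two densities define the same measure on `m₁`, so every `m₁`-measurable θ has the same
  -- integral; no finiteness is needed.
  have key : (μ.withDensity (condLExp m₁ μ f)).trim h₁ = (μ.withDensity f).trim h₁ := by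
    refine @Measure.ext _ m₁ _ _ fun s hs => ?_
    rw [trim_measurableSet_eq h₁ hs, trim_measurableSet_eq h₁ hs, withDensity_apply _ (h₁ s hs),
      withDensity_apply _ (h₁ s hs), setLIntegral_condLExp h₁ μ f hs]
  have h := congrArg (fun ν : @Measure X m₁ => ∫⁻ x, θ x ∂ν) key
  simp only [lintegral_trim h₁ hθ] at h
  rw [lintegral_withDensity_eq_lintegral_mul _ (measurable_condLExp' m₁ μ f) (hθ.mono h₁ le_rfl),
    lintegral_withDensity_eq_lintegral_mul _ hf (hθ.mono h₁ le_rfl)] at h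
  simpa only [Pi.mul_apply, mul_comm] using h

theorem condLExp_mul_left (h₁ : m₁ ≤ m) {θ f : X → ℝ≥0∞} (hθ : Measurable[m₁] θ)
    (hf : Measurable f) :
    condLExp m₁ μ (fun x => θ x * f x) =ᵐ[μ] fun x => θ x * condLExp m₁ μ f x := by
  refine (ae_eq_condLExp h₁ μ _ (hθ.mul (measurable_condLExp m₁ μ f)) fun s hs => ?_).symm
  have := lintegral_mul_condLExp (μ := μ) h₁ (hθ.indicator hs) hf
  rw [← lintegral_indicator (h₁ s hs), ← lintegral_indicator (h₁ s hs)]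
  convert this using 3 with x x <;> by_cases hx : x ∈ s <;> simp [hx]

theorem le_condLExp (h₁ : m₁ ≤ m) {f g : X → ℝ≥0∞} (hg : Measurable[m₁] g)
    (h : ∀ s, MeasurableSet[m₁] s → ∫⁻ x in s, g x ∂μ ≤ ∫⁻ x in s, f x ∂μ) :
    g ≤ᵐ[μ] condLExp m₁ μ f := by
  refine ae_le_of_ae_le_trim (hm := h₁) ?_
  refine ae_le_of_forall_setLIntegral_le_of_sigmaFinite hg ?_
  intro s hs _
  rw [setLIntegral_condLExp_trim h₁ μ f hs, setLIntegral_trim h₁ hg hs]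
  exact h s hs

end CondLExp

/-! ### Pathwise inequalities for increasing sequences -/

theorem mul_rpow_sub_one_le {q a b : ℝ} (hq : 1 < q) (ha : 0 ≤ a) (hb : 0 ≤ b) :
    a * b ^ (q - 1) ≤ q⁻¹ * a ^ q + (1 - q⁻¹) * b ^ q := by
  have h := Real.young_inequality_of_nonneg ha (Real.rpow_nonneg hb (q - 1))
    (Real.HolderConjugate.conjExponent hq)
  have h1 : (b ^ (q - 1)) ^ q.conjExponent = b ^ q := by
    rw [← Real.rpow_mul hb, Real.conjExponent, mul_div_cancel₀ _ (by linarith)]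
  have h2 : q.conjExponent⁻¹ = 1 - q⁻¹ := by
    rw [Real.conjExponent]; field_simp
  rw [h1, div_eq_mul_inv, div_eq_mul_inv, h2] at h
  linarith

/-- Discrete form of ∫_0^Z (Z - t) d(t^(q-1)) = Z^q / q: the left endpoints z_n overestimate the
integrand. -/
theorem rpow_le_sum_sub_mul {q : ℝ} (hq : 1 < q) {z : ℕ → ℝ} (hz : Monotone z) (h0 : z 0 = 0)
    (K : ℕ) : z K ^ q ≤
      q * ∑ n ∈ Finset.range K, (z K - z n) * (z (n + 1) ^ (q - 1) - z n ^ (q - 1)) := by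
  have hpos : ∀ n, 0 ≤ z n := fun n => h0 ▸ hz (Nat.zero_le n)
  have hpow : ∀ n, z n ^ q = z n * z n ^ (q - 1) := fun n => by
    rcases (hpos n).eq_or_lt with h | h
    · rw [← h, Real.zero_rpow (by linarith), zero_mul]
    · rw [← Real.rpow_one_add' h.le (by linarith)]; congr 1; ring
  -- The left side is the integral of z_K - t against d(t^(q-1)) up to z_j; Young's inequality
  -- compares one increment, and j = K leaves z_K^q / q.
  have key : ∀ j, z K * z j ^ (q - 1) - (1 - q⁻¹) * z j ^ q ≤
      ∑ n ∈ Finset.range j, (z K - z n) * (z (n + 1) ^ (q - 1) - z n ^ (q - 1)) := by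
    intro j
    induction j with
    | zero => simp [h0, Real.zero_rpow (by linarith : q ≠ 0), Real.zero_rpow (by linarith : q - 1 ≠ 0)]
    | succ n ih =>
      rw [Finset.sum_range_succ]
      have := mul_rpow_sub_one_le hq (hpos n) (hpos (n + 1))
      nlinarith [hpow n]
  have := key K
  rw [← hpow] at this
  calc z K ^ q = q * (z K ^ q - (1 - q⁻¹) * z K ^ q) := by field_simp; ring
    _ ≤ _ := by gcongr

/-- Discrete form of ∫_0^Z t d(t^(q-1)) = (1 - 1/q) Z^q, with right endpoints. -/
theorem rpow_le_sum_mul {q : ℝ} (hq : 1 < q) {z : ℕ → ℝ} (hz : Monotone z) (h0 : z 0 = 0)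
    (K : ℕ) : z K ^ q ≤
      q / (q - 1) * ∑ n ∈ Finset.range K, z (n + 1) * (z (n + 1) ^ (q - 1) - z n ^ (q - 1)) := by
  have hpos : ∀ n, 0 ≤ z n := fun n => h0 ▸ hz (Nat.zero_le n)
  have hpow : ∀ n, z n ^ q = z n * z n ^ (q - 1) := fun n => by
    rcases (hpos n).eq_or_lt with h | h
    · rw [← h, Real.zero_rpow (by linarith), zero_mul]
    · rw [← Real.rpow_one_add' h.le (by linarith)]; congr 1; ring
  have key : ∀ j, (1 - q⁻¹) * z j ^ q ≤
      ∑ n ∈ Finset.range j, z (n + 1) * (z (n + 1) ^ (q - 1) - z n ^ (q - 1)) := by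
    intro j
    induction j with
    | zero => simp [h0, Real.zero_rpow (by linarith : q ≠ 0)]
    | succ n ih =>
      rw [Finset.sum_range_succ]
      have := mul_rpow_sub_one_le hq (hpos (n + 1)) (hpos n)
      nlinarith [hpow (n + 1)]
  have h1 : 0 < q - 1 := by linarith
  calc z K ^ q = q / (q - 1) * ((1 - q⁻¹) * z K ^ q) := by field_simp
    _ ≤ _ := by gcongr; exact key K

theorem coe_rpow_tsub_coe_rpow {q : ℝ} (hq : 1 < q) {z : ℕ → ℝ≥0} (n : ℕ) :
    (z (n + 1) : ℝ≥0∞) ^ (q - 1) - (z n : ℝ≥0∞) ^ (q - 1) =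
      ((z (n + 1) ^ (q - 1) - z n ^ (q - 1) : ℝ≥0) : ℝ≥0∞) := by
  have h1 : 0 ≤ q - 1 := by linarith
  rw [ENNReal.coe_sub, ENNReal.coe_rpow_of_nonneg _ h1, ENNReal.coe_rpow_of_nonneg _ h1]

theorem ennreal_rpow_le_sum_sub_mul {q : ℝ} (hq : 1 < q) {z : ℕ → ℝ≥0∞} (hz : Monotone z)
    (h0 : z 0 = 0) (hfin : ∀ n, z n ≠ ∞) (K : ℕ) : z K ^ q ≤ ENNReal.ofReal q *
      ∑ n ∈ Finset.range K, (z (n + 1) ^ (q - 1) - z n ^ (q - 1)) * (z K - z n) := by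
  lift z to ℕ → ℝ≥0 using hfin
  have hz' : Monotone z := fun a b h => ENNReal.coe_le_coe.1 (hz h)
  have h1 : 0 ≤ q - 1 := by linarith
  have hr := rpow_le_sum_sub_mul hq (z := fun n => (z n : ℝ)) (fun a b h => by exact_mod_cast hz' h)
    (by simpa using h0) K
  simp only [coe_rpow_tsub_coe_rpow hq]
  have h2 : ∀ n ∈ Finset.range K, ((z K : ℝ) - z n) * ((z (n + 1) : ℝ) ^ (q - 1) -
      (z n : ℝ) ^ (q - 1)) = (((z (n + 1) ^ (q - 1) - z n ^ (q - 1)) * (z K - z n) : ℝ≥0) : ℝ) := by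
    intro n hn
    rw [NNReal.coe_mul, NNReal.coe_sub (hz' (Finset.mem_range.1 hn).le),
      NNReal.coe_sub (NNReal.rpow_le_rpow (hz' n.le_succ) h1)]
    push_cast; ring
  rw [Finset.sum_congr rfl h2] at hr
  lift q to ℝ≥0 using by linarith
  rw [ENNReal.ofReal_coe_nnreal, ← ENNReal.coe_rpow_of_nonneg _ (by linarith)]
  exact_mod_cast hr

theorem ennreal_rpow_le_sum_mul {q : ℝ} (hq : 1 < q) {z : ℕ → ℝ≥0∞} (hz : Monotone z)
    (h0 : z 0 = 0) (hfin : ∀ n, z n ≠ ∞) (K : ℕ) : z K ^ q ≤ ENNReal.ofReal (q / (q - 1)) *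
      ∑ n ∈ Finset.range K, (z (n + 1) ^ (q - 1) - z n ^ (q - 1)) * z (n + 1) := by
  lift z to ℕ → ℝ≥0 using hfin
  have hz' : Monotone z := fun a b h => ENNReal.coe_le_coe.1 (hz h)
  have h1 : 0 ≤ q - 1 := by linarith
  have hr := rpow_le_sum_mul hq (z := fun n => (z n : ℝ)) (fun a b h => by exact_mod_cast hz' h)
    (by simpa using h0) K
  simp only [coe_rpow_tsub_coe_rpow hq]
  have h2 : ∀ n ∈ Finset.range K, (z (n + 1) : ℝ) * ((z (n + 1) : ℝ) ^ (q - 1) -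
      (z n : ℝ) ^ (q - 1)) = (((z (n + 1) ^ (q - 1) - z n ^ (q - 1)) * z (n + 1) : ℝ≥0) : ℝ) := by
    intro n hn
    rw [NNReal.coe_mul, NNReal.coe_sub (NNReal.rpow_le_rpow (hz' n.le_succ) h1)]
    push_cast; ring
  rw [Finset.sum_congr rfl h2] at hr
  have hc : 0 ≤ q / (q - 1) := by positivity
  generalize q / (q - 1) = c at hc hr ⊢
  lift c to ℝ≥0 using hc
  rw [ENNReal.ofReal_coe_nnreal, ← ENNReal.coe_rpow_of_nonneg _ (by linarith)]
  exact_mod_cast hr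

theorem sum_range_tsub_of_monotone {z : ℕ → ℝ≥0∞} (hz : Monotone z) (h0 : z 0 = 0) (K : ℕ) :
    ∑ n ∈ Finset.range K, (z (n + 1) - z n) = z K := by
  induction K with
  | zero => simp [h0]
  | succ n ih => rw [Finset.sum_range_succ, ih, add_tsub_cancel_of_le (hz n.le_succ)]

/-! ### Maximal inequalities by absorption -/

section Scalar

variable {m : MeasurableSpace X} {μ : Measure X}

/-- According to whether V ≤ 2cW, the quantity c V^(q-1) W is at most (2cW)^q or V^q / 2. The half
is absorbed on the left, which requires ∫ V^q < ∞; this is where the bound `L` serves. -/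
theorem lintegral_rpow_le_of_le_lintegral_mul [IsProbabilityMeasure μ] {q : ℝ} (hq : 1 < q) {c : ℝ≥0} {L : ℝ≥0}
    {V W : X → ℝ≥0∞} (hV : Measurable V) (hVL : ∀ x, V x ≤ L)
    (h : ∫⁻ x, V x ^ q ∂μ ≤ c * ∫⁻ x, V x ^ (q - 1) * W x ∂μ) :
    ∫⁻ x, V x ^ q ∂μ ≤ 2 * (2 * c) ^ q * ∫⁻ x, W x ^ q ∂μ := by
  have h1 : 0 < q - 1 := by linarith
  have hpt : ∀ x, c * (V x ^ (q - 1) * W x) ≤ 2⁻¹ * V x ^ q + (2 * c) ^ q * W x ^ q := by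
    intro x
    rw [← ENNReal.mul_rpow_of_nonneg _ _ (by linarith)]
    rcases le_total (V x) (2 * c * W x) with hx | hx
    · calc c * (V x ^ (q - 1) * W x) ≤ (2 * c * W x) ^ (q - 1) * (2 * c * W x) ^ (1 : ℝ) := by
            rw [ENNReal.rpow_one]
            calc c * (V x ^ (q - 1) * W x) = V x ^ (q - 1) * (1 * c * W x) := by ring
              _ ≤ _ := by gcongr; norm_num
        _ = (2 * c * W x) ^ q := by
            rw [← ENNReal.rpow_add_of_nonneg _ _ h1.le zero_le_one]; congr 1; ring
        _ ≤ _ := le_add_self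
    · calc c * (V x ^ (q - 1) * W x) = V x ^ (q - 1) * (2⁻¹ * (2 * c * W x)) := by
            rw [← mul_assoc, ← mul_assoc 2⁻¹, ← mul_assoc 2⁻¹,
              ENNReal.inv_mul_cancel (by norm_num) (by norm_num)]; ring
        _ ≤ V x ^ (q - 1) * (2⁻¹ * V x ^ (1 : ℝ)) := by rw [ENNReal.rpow_one]; gcongr
        _ = 2⁻¹ * V x ^ q := by
            rw [mul_left_comm, ← ENNReal.rpow_add_of_nonneg _ _ h1.le zero_le_one]
            congr 2; ring
        _ ≤ _ := le_self_add
  have hfin : ∫⁻ x, V x ^ q ∂μ ≠ ∞ := by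
    refine ne_top_of_le_ne_top (b := ∫⁻ _, (L : ℝ≥0∞) ^ q ∂μ) ?_ (lintegral_mono fun x => ?_)
    · simp only [lintegral_const, measure_univ, mul_one]
      exact ENNReal.rpow_ne_top_of_nonneg (by linarith) ENNReal.coe_ne_top
    · exact ENNReal.rpow_le_rpow (hVL x) (by linarith)
  set I := ∫⁻ x, V x ^ q ∂μ
  set J := ∫⁻ x, W x ^ q ∂μ
  have h2 : I ≤ 2⁻¹ * I + (2 * c) ^ q * J := by
    refine h.trans ?_
    rw [← lintegral_const_mul' _ _ ENNReal.coe_ne_top]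
    refine (lintegral_mono hpt).trans ?_
    rw [lintegral_add_left ((hV.pow_const q).const_mul _), lintegral_const_mul _ (hV.pow_const q),
      lintegral_const_mul' _ _ (ENNReal.rpow_ne_top_of_nonneg (by linarith)
        (ENNReal.mul_ne_top (by norm_num) ENNReal.coe_ne_top))]
  have h3 : I = 2⁻¹ * I + 2⁻¹ * I := by
    rw [← add_mul, ENNReal.inv_two_add_inv_two, one_mul]
  have h4 : 2⁻¹ * I ≤ (2 * c) ^ q * J := by
    have : 2⁻¹ * I ≠ ∞ := ENNReal.mul_ne_top (by norm_num) hfin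
    refine (ENNReal.add_le_add_iff_left this).1 ?_
    rwa [← h3]
  calc I = 2 * (2⁻¹ * I) := by
        rw [← mul_assoc, ENNReal.mul_inv_cancel (by norm_num) (by norm_num), one_mul]
    _ ≤ 2 * ((2 * c) ^ q * J) := by gcongr
    _ = _ := by ring

theorem lintegral_rpow_le_of_truncations {q : ℝ} (hq : 0 < q) {V : X → ℝ≥0∞} (hV : Measurable V)
    {B : ℝ≥0∞} (h : ∀ L : ℕ, ∫⁻ x, min (V x) L ^ q ∂μ ≤ B) : ∫⁻ x, V x ^ q ∂μ ≤ B := by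
  have hmono : Monotone fun (L : ℕ) x => min (V x) (L : ℝ≥0∞) ^ q := fun a b hab x =>
    ENNReal.rpow_le_rpow (min_le_min_left _ (by exact_mod_cast hab)) hq.le
  have hsup : ∀ x, ⨆ L : ℕ, min (V x) (L : ℝ≥0∞) ^ q = V x ^ q := by
    intro x
    have := (ENNReal.orderIsoRpow q hq).map_iSup (fun L : ℕ => min (V x) (L : ℝ≥0∞))
    simp only [ENNReal.orderIsoRpow_apply] at this
    rw [← this, ← inf_iSup_eq, ENNReal.iSup_natCast, inf_top_eq]
  simp_rw [← hsup]
  rw [lintegral_iSup (fun L => (hV.min measurable_const).pow_const q) hmono]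
  exact iSup_le h

variable [IsProbabilityMeasure μ]

/-- The Garsia–Neveu inequality for an increasing process `Z` with `Z (n + 1)` measurable with
respect to `ℋ n`. -/
theorem lintegral_rpow_le_of_forall_lintegral_mul_tsub_le {q : ℝ} (hq : 1 < q)
    (ℋ : Filtration ℕ m) {Z : ℕ → X → ℝ≥0∞} (h0 : Z 0 = 0)
    (hmeas : ∀ n, Measurable[ℋ n] (Z (n + 1))) (hmono : Monotone Z) {W : X → ℝ≥0∞}
    (hW : Measurable W) (K : ℕ)
    (h : ∀ n < K, ∀ θ : X → ℝ≥0∞, Measurable[ℋ n] θ →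
      ∫⁻ x, θ x * (Z K x - Z n x) ∂μ ≤ ∫⁻ x, θ x * W x ∂μ) :
    ∫⁻ x, Z K x ^ q ∂μ ≤ 2 * (2 * q.toNNReal) ^ q * ∫⁻ x, W x ^ q ∂μ := by
  have h1 : 0 < q - 1 := by linarith
  have hZ : ∀ n, Measurable (Z n) := by
    rintro (_ | n)
    · rw [h0]; exact measurable_zero
    · exact (hmeas n).mono (ℋ.le n) le_rfl
  have hZn : ∀ n, Measurable[ℋ n] (Z n) := by
    rintro (_ | n)
    · rw [h0]; exact @measurable_zero _ _ _ (ℋ 0) _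
    · exact (hmeas n).mono (ℋ.mono n.le_succ) le_rfl
  refine lintegral_rpow_le_of_truncations (by linarith) (hZ K) fun L => ?_
  let z : ℕ → X → ℝ≥0∞ := fun n x => min (Z n x) L
  have hzmono : ∀ x, Monotone fun n => z n x := fun x a b hab => min_le_min_right _ (hmono hab x)
  have hz0 : ∀ x, z 0 x = 0 := fun x => by simp [z, h0]
  have hzfin : ∀ n x, z n x ≠ ∞ := fun n x => ne_top_of_le_ne_top (by simp) (min_le_right _ _)
  have hz : ∀ n, Measurable (z n) := fun n => (hZ n).min measurable_const
  -- Since `Z (n + 1)` is already `ℋ n`-measurable, the increments of z^(q-1) are admissible weights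
  -- in `h`.
  have hθ : ∀ n, Measurable[ℋ n] fun x => z (n + 1) x ^ (q - 1) - z n x ^ (q - 1) := fun n =>
    (((hmeas n).min measurable_const).pow_const _).sub (((hZn n).min measurable_const).pow_const _)
  refine lintegral_rpow_le_of_le_lintegral_mul (L := L) hq (hz K)
    (fun x => (min_le_right _ _).trans (by simp)) ?_
  calc ∫⁻ x, z K x ^ q ∂μ
      ≤ ∫⁻ x, ENNReal.ofReal q * ∑ n ∈ Finset.range K,
          (z (n + 1) x ^ (q - 1) - z n x ^ (q - 1)) * (z K x - z n x) ∂μ :=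
        lintegral_mono fun x => ennreal_rpow_le_sum_sub_mul hq (hzmono x) (hz0 x)
          (fun n => hzfin n x) K
    _ = ENNReal.ofReal q * ∑ n ∈ Finset.range K, ∫⁻ x,
          (z (n + 1) x ^ (q - 1) - z n x ^ (q - 1)) * (z K x - z n x) ∂μ := by
        rw [lintegral_const_mul' _ _ ENNReal.ofReal_ne_top, lintegral_finsetSum]
        exact fun n _ => ((hθ n).mono (ℋ.le n) le_rfl).mul ((hz K).sub (hz n))
    _ ≤ ENNReal.ofReal q * ∑ n ∈ Finset.range K, ∫⁻ x,
          (z (n + 1) x ^ (q - 1) - z n x ^ (q - 1)) * W x ∂μ := by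
        refine mul_le_mul' le_rfl (Finset.sum_le_sum fun n hn => ?_)
        refine le_trans (lintegral_mono fun x => ?_) (h n (Finset.mem_range.1 hn) _ (hθ n))
        refine mul_le_mul' le_rfl ?_
        -- Truncation at `L` can only shrink the increment from n to K.
        rw [tsub_le_iff_right]
        simp only [z]
        have := hmono (Finset.mem_range.1 hn).le x
        rcases le_total (Z n x) L with hL | hL
        · rw [min_eq_left hL, tsub_add_cancel_of_le this]; exact min_le_left _ _
        · rw [min_eq_right hL]; exact (min_le_right _ _).trans le_add_self
    _ = ENNReal.ofReal q * ∫⁻ x, z K x ^ (q - 1) * W x ∂μ := by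
        rw [← lintegral_finsetSum]
        swap
        · exact fun n _ => ((hθ n).mono (ℋ.le n) le_rfl).mul hW
        congr 1
        refine lintegral_congr fun x => ?_
        rw [← Finset.sum_mul, sum_range_tsub_of_monotone (z := fun n => z n x ^ (q - 1))
          (fun a b hab => ENNReal.rpow_le_rpow (hzmono x hab) h1.le) (by simp [hz0, h1])]

/-- The maximum of `0` and of the first terms of a sequence of functions. -/
def runMax (U : ℕ → X → ℝ≥0∞) : ℕ → X → ℝ≥0∞
  | 0 => 0
  | n + 1 => fun x => max (runMax U n x) (U n x)

theorem runMax_mono (U : ℕ → X → ℝ≥0∞) : Monotone (runMax U) :=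
  monotone_nat_of_le_succ fun _ _ => le_max_left _ _

theorem le_runMax (U : ℕ → X → ℝ≥0∞) {n K : ℕ} (h : n < K) (x : X) : U n x ≤ runMax U K x :=
  (le_max_right _ _).trans (runMax_mono U (Nat.succ_le_of_lt h) x)

theorem runMax_congr {U V : ℕ → X → ℝ≥0∞} {K : ℕ} (h : ∀ n < K, U n = V n) :
    runMax U K = runMax V K := by
  induction K with
  | zero => rfl
  | succ n ih =>
    funext x
    simp only [runMax, ih fun k hk => h k (hk.trans n.lt_succ_self), h n n.lt_succ_self]

theorem measurable_runMax {m' : MeasurableSpace X} {U : ℕ → X → ℝ≥0∞} {K : ℕ}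
    (h : ∀ n < K, Measurable (U n)) : Measurable (runMax U K) := by
  induction K with
  | zero => exact measurable_zero
  | succ n ih =>
    exact (ih fun k hk => h k (hk.trans n.lt_succ_self)).max (h n n.lt_succ_self)

theorem runMax_rpow {r : ℝ} (hr : 0 < r) (U : ℕ → X → ℝ≥0∞) (K : ℕ) (x : X) :
    runMax U K x ^ r = runMax (fun n x => U n x ^ r) K x := by
  induction K with
  | zero => simp [runMax, hr]
  | succ n ih =>
    simp only [runMax, ← ih]
    exact (ENNReal.monotone_rpow_of_nonneg hr.le).map_max

/-- Doob's maximal inequality. -/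
theorem lintegral_runMax_rpow_le {q : ℝ} (hq : 1 < q) (ℋ : Filtration ℕ m) {G : X → ℝ≥0∞}
    (hG : Measurable G) (K : ℕ) :
    ∫⁻ x, runMax (fun n => condLExp (ℋ n) μ G) K x ^ q ∂μ ≤
      2 * (2 * (q / (q - 1)).toNNReal) ^ q * ∫⁻ x, G x ^ q ∂μ := by
  have h1 : 0 < q - 1 := by linarith
  set U : ℕ → X → ℝ≥0∞ := fun n => condLExp (ℋ n) μ G
  have hU : ∀ n, Measurable[ℋ n] (U n) := fun n => measurable_condLExp _ _ _
  have hM : ∀ n, Measurable (runMax U n) := fun n =>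
    measurable_runMax fun k _ => (hU k).mono (ℋ.le k) le_rfl
  refine lintegral_rpow_le_of_truncations (by linarith) (hM K) fun L => ?_
  let z : ℕ → X → ℝ≥0∞ := fun n x => min (runMax U n x) L
  have hzmono : ∀ x, Monotone fun n => z n x :=
    fun x a b hab => min_le_min_right _ (runMax_mono U hab x)
  have hz0 : ∀ x, z 0 x = 0 := fun x => by simp [z, runMax]
  have hzfin : ∀ n x, z n x ≠ ∞ := fun n x => ne_top_of_le_ne_top (by simp) (min_le_right _ _)
  have hz : ∀ n, Measurable (z n) := fun n => (hM n).min measurable_const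
  have hθ : ∀ n, Measurable[ℋ n] fun x => z (n + 1) x ^ (q - 1) - z n x ^ (q - 1) := by
    intro n
    have h2 : ∀ j ≤ n + 1, Measurable[ℋ n] (runMax U j) := fun j hj =>
      @measurable_runMax _ (ℋ n) _ _ fun k hk => (hU k).mono (ℋ.mono (by omega)) le_rfl
    exact (((h2 _ le_rfl).min measurable_const).pow_const _).sub
      (((h2 n n.le_succ).min measurable_const).pow_const _)
  refine lintegral_rpow_le_of_le_lintegral_mul (L := L) hq (hz K)
    (fun x => (min_le_right _ _).trans (by simp)) ?_
  calc ∫⁻ x, z K x ^ q ∂μ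
      ≤ ∫⁻ x, ENNReal.ofReal (q / (q - 1)) * ∑ n ∈ Finset.range K,
          (z (n + 1) x ^ (q - 1) - z n x ^ (q - 1)) * U n x ∂μ := by
        refine lintegral_mono fun x => (ennreal_rpow_le_sum_mul hq (hzmono x) (hz0 x)
          (fun n => hzfin n x) K).trans ?_
        -- The increment vanishes unless `U n` exceeds the earlier maximum, and then z_{n+1} ≤ U_n.
        refine mul_le_mul' le_rfl (Finset.sum_le_sum fun n hn => ?_)
        rcases le_total (runMax U n x) (U n x) with hx | hx
        · gcongr
          simp only [z, runMax, max_eq_right hx]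
          exact min_le_left _ _
        · simp [z, runMax, max_eq_left hx]
    _ = ENNReal.ofReal (q / (q - 1)) * ∑ n ∈ Finset.range K, ∫⁻ x,
          (z (n + 1) x ^ (q - 1) - z n x ^ (q - 1)) * U n x ∂μ := by
        rw [lintegral_const_mul' _ _ ENNReal.ofReal_ne_top, lintegral_finsetSum]
        exact fun n _ => ((hθ n).mono (ℋ.le n) le_rfl).mul ((hU n).mono (ℋ.le n) le_rfl)
    _ = ENNReal.ofReal (q / (q - 1)) * ∑ n ∈ Finset.range K, ∫⁻ x,
          (z (n + 1) x ^ (q - 1) - z n x ^ (q - 1)) * G x ∂μ := by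
        congr 1
        exact Finset.sum_congr rfl fun n _ => lintegral_mul_condLExp (ℋ.le n) (hθ n) hG
    _ = ENNReal.ofReal (q / (q - 1)) * ∫⁻ x, z K x ^ (q - 1) * G x ∂μ := by
        rw [← lintegral_finsetSum]
        swap
        · exact fun n _ => ((hθ n).mono (ℋ.le n) le_rfl).mul hG
        congr 1
        refine lintegral_congr fun x => ?_
        rw [← Finset.sum_mul, sum_range_tsub_of_monotone (z := fun n => z n x ^ (q - 1))
          (fun a b hab => ENNReal.rpow_le_rpow (hzmono x hab) h1.le) (by simp [hz0, h1])]

end Scalar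

/-! ### Extrapolation for operators resembling partial norms -/

/-- An operator `N` on non-negative functions that behaves like a norm taken in some of the
variables: `ℛ` is the σ-algebra generated by the other variables, and `ℋ n` consists of the events
of `𝒢 n` that depend only on the other variables. -/
structure IsPartialNorm {X : Type u} (ℛ : MeasurableSpace X) {m : MeasurableSpace X}
    (μ : Measure X) (𝒢 ℋ : Filtration ℕ m) (N : (X → ℝ≥0∞) → X → ℝ≥0∞) : Prop where
  le : ∀ n, ℋ n ≤ 𝒢 n
  le_range : ∀ n, ℋ n ≤ ℛ
  range_le : ℛ ≤ m
  measurable : ∀ {f}, Measurable f → Measurable[ℛ] (N f)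
  adapted : ∀ {n f}, Measurable[𝒢 n] f → Measurable[ℋ n] (N f)
  mul : ∀ {θ f}, Measurable[ℛ] θ → Measurable f → N (fun x => θ x * f x) = fun x => θ x * N f x
  mono : ∀ {f g : X → ℝ≥0∞}, f ≤ g → N f ≤ N g
  add : ∀ {f g}, Measurable f → Measurable g → N (fun x => f x + g x) ≤ fun x => N f x + N g x
  congr : ∀ {f g}, Measurable f → Measurable g → f =ᵐ[μ] g → N f =ᵐ[μ] N g
  condLExp : ∀ {n f}, Measurable f → N (condLExp (𝒢 n) μ f) ≤ᵐ[μ] condLExp (ℋ n) μ (N f)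

/-- The inequality `∫ N(∑ E_n f_n)^q ≤ C ∫ N(∑ f_n)^q` for finite sums. -/
def SumBound {X : Type u} {m : MeasurableSpace X} (μ : Measure X) (𝒢 : Filtration ℕ m)
    (N : (X → ℝ≥0∞) → X → ℝ≥0∞) (q : ℝ) (C : ℝ≥0) : Prop :=
  ∀ (K : ℕ) (f : ℕ → X → ℝ≥0∞), (∀ n, Measurable (f n)) →
    ∫⁻ x, N (fun y => ∑ n ∈ Finset.range K, condLExp (𝒢 n) μ (f n) y) x ^ q ∂μ ≤
      C * ∫⁻ x, N (fun y => ∑ n ∈ Finset.range K, f n y) x ^ q ∂μ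

namespace IsPartialNorm

variable {ℛ m : MeasurableSpace X} {μ : Measure X} {𝒢 ℋ : Filtration ℕ m}
  {N : (X → ℝ≥0∞) → X → ℝ≥0∞}

theorem measurable' (hN : IsPartialNorm ℛ μ 𝒢 ℋ N) {f : X → ℝ≥0∞} (hf : Measurable f) :
    Measurable (N f) := (hN.measurable hf).mono hN.range_le le_rfl

theorem zero (hN : IsPartialNorm ℛ μ 𝒢 ℋ N) : N (fun _ => 0) = fun _ => 0 := by
  have := hN.mul (θ := fun _ => 0) (f := fun _ => 0) (@measurable_const _ _ _ ℛ _) measurable_const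
  simpa using this

theorem mono_ae (hN : IsPartialNorm ℛ μ 𝒢 ℋ N) {f g : X → ℝ≥0∞} (hf : Measurable f)
    (hg : Measurable g) (h : f ≤ᵐ[μ] g) : N f ≤ᵐ[μ] N g := by
  have h1 : f =ᵐ[μ] fun x => min (f x) (g x) := h.mono fun x hx => (min_eq_left hx).symm
  filter_upwards [hN.congr hf (hf.min hg) h1] with x hx
  rw [hx]
  exact hN.mono (fun y => min_le_right _ _) x

theorem sum (hN : IsPartialNorm ℛ μ 𝒢 ℋ N) {f : ℕ → X → ℝ≥0∞} (hf : ∀ n, Measurable (f n))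
    (K : ℕ) : N (fun x => ∑ n ∈ Finset.range K, f n x) ≤
      fun x => ∑ n ∈ Finset.range K, N (f n) x := by
  induction K with
  | zero => simp [hN.zero]
  | succ n ih =>
    simp only [Finset.sum_range_succ]
    refine (hN.add (Finset.measurable_fun_sum _ fun k _ => hf k) (hf n)).trans fun x => ?_
    exact add_le_add_left (ih x) _

variable [IsProbabilityMeasure μ]

/-- Localisation of the inequality of `SumBound`. -/
theorem lintegral_mul_le (hN : IsPartialNorm ℛ μ 𝒢 ℋ N) {r : ℝ} (hr : 1 ≤ r) {C : ℝ≥0}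
    (hC : SumBound μ 𝒢 N r C) {n : ℕ} {θ : X → ℝ≥0∞} (hθ : Measurable[𝒢 n] θ)
    (hθ' : Measurable[ℛ] θ) {f : ℕ → X → ℝ≥0∞} (hf : ∀ k, Measurable (f k)) (K : ℕ) :
    ∫⁻ x, θ x * N (fun y => ∑ k ∈ Finset.Ico n K, MeasureTheory.condLExp (𝒢 k) μ (f k) y) x ^ r ∂μ
      ≤ C * ∫⁻ x, θ x * N (fun y => ∑ k ∈ Finset.range K, f k y) x ^ r ∂μ := by
  have hr0 : 0 < r := by linarith
  -- Apply the bound to θ^(1/r) f_k for k ≥ n and to 0 for k < n: the weight passes through E_k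
  -- because it is known at time n, and through `N` because it depends only on the other variables.
  let ϑ : X → ℝ≥0∞ := fun x => θ x ^ r⁻¹
  have hϑ : Measurable[𝒢 n] ϑ := hθ.pow_const _
  have hϑ' : Measurable[ℛ] ϑ := hθ'.pow_const _
  have hϑm : Measurable ϑ := hϑ.mono (𝒢.le n) le_rfl
  have hpow : ∀ x, ϑ x ^ r = θ x := fun x => ENNReal.rpow_inv_rpow hr0.ne' _
  let f' : ℕ → X → ℝ≥0∞ := fun k => if n ≤ k then fun x => ϑ x * f k x else fun _ => 0
  have hf' : ∀ k, Measurable (f' k) := by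
    intro k
    by_cases hk : n ≤ k
    · simp only [f', hk, if_true]; exact hϑm.mul (hf k)
    · simp only [f', hk, if_false]; exact measurable_const
  have hcond : ∀ k, MeasureTheory.condLExp (𝒢 k) μ (f' k) =ᵐ[μ]
      if n ≤ k then fun x => ϑ x * MeasureTheory.condLExp (𝒢 k) μ (f k) x else fun _ => 0 := by
    intro k
    by_cases hk : n ≤ k
    · simp only [f', hk, if_true]
      exact condLExp_mul_left (𝒢.le k) (hϑ.mono (𝒢.mono hk) le_rfl) (hf k)
    · simp only [f', hk, if_false]
      rw [condLExp_const (𝒢.le k) μ 0]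
  have hA : Measurable fun y => ∑ k ∈ Finset.Ico n K, MeasureTheory.condLExp (𝒢 k) μ (f k) y :=
    Finset.measurable_fun_sum _ fun k _ => measurable_condLExp' _ _ _
  have hF : Measurable fun y => ∑ k ∈ Finset.range K, f k y :=
    Finset.measurable_fun_sum _ fun k _ => hf k
  have h1 : (fun y => ∑ k ∈ Finset.range K, MeasureTheory.condLExp (𝒢 k) μ (f' k) y) =ᵐ[μ]
      fun y => ϑ y * ∑ k ∈ Finset.Ico n K, MeasureTheory.condLExp (𝒢 k) μ (f k) y := by
    filter_upwards [ae_all_iff.2 hcond] with y hy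
    rw [Finset.mul_sum, Finset.range_eq_Ico,
      ← Finset.sum_subset (Finset.Ico_subset_Ico_left (Nat.zero_le n))]
    · refine Finset.sum_congr rfl fun k hk => ?_
      rw [hy k, if_pos (Finset.mem_Ico.1 hk).1]
    · intro k hk hk'
      rw [hy k, if_neg]
      simp only [Finset.mem_Ico] at hk hk'
      omega
  have h2 := hN.congr (Finset.measurable_fun_sum _ fun k _ => measurable_condLExp' _ _ _)
    (hϑm.fun_mul hA) h1
  rw [hN.mul hϑ' hA] at h2
  calc _ = ∫⁻ x, N (fun y => ∑ k ∈ Finset.range K,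
          MeasureTheory.condLExp (𝒢 k) μ (f' k) y) x ^ r ∂μ := by
        refine lintegral_congr_ae (h2.mono fun x hx => ?_)
        simp only at hx ⊢
        rw [hx, ENNReal.mul_rpow_of_nonneg _ _ hr0.le, hpow]
    _ ≤ C * ∫⁻ x, N (fun y => ∑ k ∈ Finset.range K, f' k y) x ^ r ∂μ := hC K f' hf'
    _ ≤ C * ∫⁻ x, N (fun y => ϑ y * ∑ k ∈ Finset.range K, f k y) x ^ r ∂μ := by
        gcongr with x
        refine hN.mono (fun y => ?_) x
        simp only [Finset.mul_sum]
        gcongr with k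
        by_cases hk : n ≤ k <;> simp [f', hk]
    _ = _ := by
        rw [hN.mul hϑ' hF]
        simp only [ENNReal.mul_rpow_of_nonneg _ _ hr0.le, hpow]

end IsPartialNorm

/-- Equality can fail at a = ∞, where the left side is 0 · ∞ = 0 for r > 1. -/
theorem rpow_one_sub_mul_rpow_le {r : ℝ} (hr : 1 ≤ r) (a : ℝ≥0∞) : a ^ (1 - r) * a ^ r ≤ a := by
  rcases eq_or_ne a 0 with rfl | h0
  · rw [ENNReal.zero_rpow_of_pos (by linarith : 0 < r), mul_zero]
  rcases eq_or_ne a ∞ with rfl | h1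
  · exact le_top
  rw [← ENNReal.rpow_add _ _ h0 h1]
  simp

theorem rpow_le_rpow_of_nonpos {s : ℝ} (hs : s ≤ 0) {a b : ℝ≥0∞} (h : a ≤ b) :
    b ^ s ≤ a ^ s := by
  rw [← neg_neg s, ENNReal.rpow_neg, ENNReal.rpow_neg a, ENNReal.inv_le_inv]
  exact ENNReal.rpow_le_rpow h (by linarith)

/-- Chebyshev's trick: above the threshold a, the power q is dominated by the power r, so a bound at
exponent r can be used. -/
theorem rpow_le_rpow_sub_mul_rpow {r q : ℝ} (hr : 0 < r) (hqr : q ≤ r) {a b : ℝ≥0∞} (h : a < b) :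
    b ^ q ≤ a ^ (q - r) * b ^ r := by
  have hb : b ≠ 0 := (bot_le.trans_lt h).ne'
  rcases eq_or_ne b ∞ with rfl | hb'
  · rw [ENNReal.top_rpow_of_pos hr, ENNReal.mul_top]
    · exact le_top
    · rw [Ne, ENNReal.rpow_eq_zero_iff]
      rintro (⟨-, h1⟩ | ⟨h1, -⟩)
      · linarith
      · exact h.ne h1
  calc b ^ q = b ^ (q - r) * b ^ r := by rw [← ENNReal.rpow_add _ _ hb hb']; simp
    _ ≤ a ^ (q - r) * b ^ r := by
        refine mul_le_mul' ?_ le_rfl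
        exact rpow_le_rpow_of_nonpos (by linarith) h.le

theorem rpow_mul_self_le {s : ℝ} (hs : 0 < s + 1) {a : ℝ≥0∞} (ha : a ≠ 0) :
    a ^ s * a ≤ a ^ (s + 1) := by
  rcases eq_or_ne a ∞ with rfl | h1
  · rw [ENNReal.top_rpow_of_pos hs]; exact le_top
  rw [ENNReal.rpow_add _ _ ha h1, ENNReal.rpow_one]

/-- Extrapolation of `SumBound` to larger exponents. -/
theorem exists_sumBound_of_lt {r q : ℝ} (hr : 1 ≤ r) (hrq : r < q) (C : ℝ≥0) :
    ∃ C' : ℝ≥0, ∀ {X : Type u} {ℛ m : MeasurableSpace X} {μ : Measure X}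
      [IsProbabilityMeasure μ] {𝒢 ℋ : Filtration ℕ m} {N : (X → ℝ≥0∞) → X → ℝ≥0∞},
      IsPartialNorm ℛ μ 𝒢 ℋ N → SumBound μ 𝒢 N r C → SumBound μ 𝒢 N q C' := by
  have hr0 : 0 < r := by linarith
  have hq1 : 1 < q := by linarith
  have hq0 : 0 < q := by linarith
  have hqr : 1 < q / r := (one_lt_div hr0).2 hrq
  -- `c₁` is the Garsia–Neveu constant at exponent q and `c₂` the Doob constant at exponent q / r.
  set c₁ : ℝ≥0∞ := 2 * (2 * (q.toNNReal : ℝ≥0∞)) ^ q with hc₁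
  set c₂ : ℝ≥0∞ := 2 * (2 * ((q / r / (q / r - 1)).toNNReal : ℝ≥0∞)) ^ (q / r) with hc₂
  have hfin : c₁ * ((1 + C) ^ q * c₂) ≠ ∞ := by
    refine ENNReal.mul_ne_top ?_ (ENNReal.mul_ne_top ?_ ?_)
    · exact ENNReal.mul_ne_top (by simp) (ENNReal.rpow_ne_top_of_nonneg hq0.le
        (ENNReal.mul_ne_top (by simp) (by simp)))
    · exact ENNReal.rpow_ne_top_of_nonneg hq0.le (by simp)
    · exact ENNReal.mul_ne_top (by simp) (ENNReal.rpow_ne_top_of_nonneg (by linarith)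
        (ENNReal.mul_ne_top (by simp) (by simp)))
  refine ⟨(c₁ * ((1 + C) ^ q * c₂)).toNNReal, ?_⟩
  intro X ℛ m μ _ 𝒢 ℋ N hN hC K f hf
  rw [ENNReal.coe_toNNReal hfin]
  set a : ℕ → X → ℝ≥0∞ := fun n => condLExp (𝒢 n) μ (f n) with ha
  have ham : ∀ n, Measurable (a n) := fun n => measurable_condLExp' _ _ _
  set G : X → ℝ≥0∞ := N (fun y => ∑ n ∈ Finset.range K, f n y) with hGdef
  have hG : Measurable G := hN.measurable' (Finset.measurable_fun_sum _ fun k _ => hf k)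
  let Φ : ℕ → X → ℝ≥0∞ := fun n => N (fun y => ∑ k ∈ Finset.range n, a k y)
  -- The conditional L_r-size of `G` at time n. Its running maximum is controlled by Doob's
  -- inequality at q / r > 1, applied to G^r.
  let U : ℕ → X → ℝ≥0∞ := fun n x => condLExp (ℋ n) μ (fun y => G y ^ r) x ^ r⁻¹
  have hU : ∀ n, Measurable[ℋ n] (U n) := fun n => (measurable_condLExp _ _ _).pow_const _
  have hUr : ∀ n x, U n x ^ r = condLExp (ℋ n) μ (fun y => G y ^ r) x :=
    fun n x => ENNReal.rpow_inv_rpow hr0.ne' _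
  have hM : Measurable (runMax U K) :=
    measurable_runMax fun n _ => (hU n).mono (ℋ.le n) le_rfl
  have hΦ0 : Φ 0 = 0 := by
    change N (fun y => ∑ k ∈ Finset.range 0, a k y) = fun _ => 0
    simp only [Finset.sum_range_zero, hN.zero]
  have hgarsia := lintegral_rpow_le_of_forall_lintegral_mul_tsub_le (μ := μ) hq1 ℋ (Z := Φ)
    hΦ0
    (fun n => hN.adapted (Finset.measurable_fun_sum _ fun k hk =>
      (measurable_condLExp (𝒢 k) μ (f k)).mono (𝒢.mono (by simp at hk; omega)) le_rfl))
    (monotone_nat_of_le_succ fun n => hN.mono fun y => by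
      simp only [Finset.sum_range_succ]; exact le_self_add)
    (W := fun x => (1 + C) * runMax U K x) (hM.const_mul _) K ?_
  · refine hgarsia.trans ?_
    rw [mul_assoc c₁, mul_assoc _ c₂]
    refine mul_le_mul' le_rfl ?_
    simp_rw [ENNReal.mul_rpow_of_nonneg _ _ hq0.le]
    rw [lintegral_const_mul _ (hM.pow_const q)]
    gcongr
    have h1 : ∀ x, runMax U K x ^ q =
        runMax (fun n => condLExp (ℋ n) μ (fun y => G y ^ r)) K x ^ (q / r) := by
      intro x
      have : (fun n => condLExp (ℋ n) μ (fun y => G y ^ r)) = fun n x => U n x ^ r := by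
        funext n x; exact (hUr n x).symm
      rw [this, ← runMax_rpow hr0, ← ENNReal.rpow_mul, mul_div_cancel₀ _ hr0.ne']
    simp_rw [h1]
    refine (lintegral_runMax_rpow_le hqr ℋ (hG.pow_const r) K).trans ?_
    simp_rw [← ENNReal.rpow_mul, mul_div_cancel₀ _ hr0.ne']
    exact le_rfl
  · intro n hn θ hθ
    have hθm : Measurable θ := hθ.mono (ℋ.le n) le_rfl
    have hUm : Measurable (U n) := (hU n).mono (ℋ.le n) le_rfl
    set T : X → ℝ≥0∞ := N (fun y => ∑ k ∈ Finset.Ico n K, a k y) with hT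
    have hΦ : ∀ x, Φ K x - Φ n x ≤ T x := by
      intro x
      rw [tsub_le_iff_left]
      have := hN.add (f := fun y => ∑ k ∈ Finset.range n, a k y)
        (g := fun y => ∑ k ∈ Finset.Ico n K, a k y)
        (Finset.measurable_fun_sum _ fun k _ => ham k)
        (Finset.measurable_fun_sum _ fun k _ => ham k) x
      simp only [Finset.sum_range_add_sum_Ico _ hn.le] at this
      exact this
    -- Threshold at U_n. The localised bound turns T^r into G^r, whose conditional expectation is
    -- U_n^r, and U_n^(1-r) U_n^r ≤ U_n restores the first power.
    have hT' : ∀ x, T x ≤ U n x + U n x ^ (1 - r) * T x ^ r := by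
      intro x
      rcases le_or_gt (T x) (U n x) with h | h
      · exact h.trans le_self_add
      · have := rpow_le_rpow_sub_mul_rpow hr0 hr h
        rw [ENNReal.rpow_one] at this
        exact this.trans le_add_self
    have hθU : Measurable[ℋ n] fun x => θ x * U n x ^ (1 - r) := hθ.mul ((hU n).pow_const _)
    calc ∫⁻ x, θ x * (Φ K x - Φ n x) ∂μ
        ≤ ∫⁻ x, (θ x * U n x + θ x * U n x ^ (1 - r) * T x ^ r) ∂μ := by
          refine lintegral_mono fun x => ?_
          rw [mul_assoc, ← mul_add]
          exact mul_le_mul' le_rfl ((hΦ x).trans (hT' x))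
      _ = ∫⁻ x, θ x * U n x ∂μ + ∫⁻ x, θ x * U n x ^ (1 - r) * T x ^ r ∂μ :=
          lintegral_add_left (hθm.mul hUm) _
      _ ≤ ∫⁻ x, θ x * U n x ∂μ + C * ∫⁻ x, θ x * U n x ^ (1 - r) * G x ^ r ∂μ := by
          gcongr
          exact hN.lintegral_mul_le hr hC (hθU.mono (hN.le n) le_rfl)
            (hθU.mono (hN.le_range n) le_rfl) hf K
      _ = ∫⁻ x, θ x * U n x ∂μ + C * ∫⁻ x, θ x * U n x ^ (1 - r) * U n x ^ r ∂μ := by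
          rw [← lintegral_mul_condLExp (ℋ.le n) hθU (hG.pow_const r)]
          simp_rw [hUr]
      _ ≤ ∫⁻ x, θ x * U n x ∂μ + C * ∫⁻ x, θ x * U n x ∂μ := by
          refine add_le_add le_rfl (mul_le_mul' le_rfl (lintegral_mono fun x => ?_))
          rw [mul_assoc]
          exact mul_le_mul' le_rfl (rpow_one_sub_mul_rpow_le hr _)
      _ = ∫⁻ x, θ x * ((1 + C) * U n x) ∂μ := by
          rw [← one_add_mul, ← lintegral_const_mul _ (hθm.fun_mul hUm)]
          refine lintegral_congr fun x => ?_
          ring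
      _ ≤ _ := by
          gcongr with x
          exact le_runMax U hn x

/-- Extrapolation of `SumBound` to smaller exponents. -/
theorem exists_sumBound_of_gt {r q : ℝ} (hq : 1 < q) (hqr : q < r) (C : ℝ≥0) :
    ∃ C' : ℝ≥0, ∀ {X : Type u} {ℛ m : MeasurableSpace X} {μ : Measure X}
      [IsProbabilityMeasure μ] {𝒢 ℋ : Filtration ℕ m} {N : (X → ℝ≥0∞) → X → ℝ≥0∞},
      IsPartialNorm ℛ μ 𝒢 ℋ N → SumBound μ 𝒢 N r C → SumBound μ 𝒢 N q C' := by
  have hq0 : 0 < q := by linarith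
  have hr : 1 < r := by linarith
  have hr0 : 0 < r := by linarith
  set c₁ : ℝ≥0∞ := 2 * (2 * (r.toNNReal : ℝ≥0∞)) ^ r with hc₁
  set c₂ : ℝ≥0∞ := 2 * (2 * ((q / (q - 1)).toNNReal : ℝ≥0∞)) ^ q with hc₂
  have hc₁' : c₁ ≠ ∞ := ENNReal.mul_ne_top (by simp) (ENNReal.rpow_ne_top_of_nonneg hr0.le
    (ENNReal.mul_ne_top (by simp) (by simp)))
  have hc₂' : c₂ ≠ ∞ := ENNReal.mul_ne_top (by simp) (ENNReal.rpow_ne_top_of_nonneg hq0.le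
    (ENNReal.mul_ne_top (by simp) (by simp)))
  -- The first summand bounds the reweighted sum at exponent r; the 1 accounts for the region where
  -- Φ is below the maximal function D_K.
  set c₃ : ℝ≥0∞ := C * (2 ^ (r - 1) * (1 + c₁)) + 1 with hc₃
  have hc₃' : c₃ ≠ ∞ := by
    refine ENNReal.add_ne_top.2 ⟨ENNReal.mul_ne_top (by simp) (ENNReal.mul_ne_top ?_ ?_), by simp⟩
    · exact ENNReal.rpow_ne_top_of_nonneg (by linarith) (by simp)
    · exact ENNReal.add_ne_top.2 ⟨by simp, hc₁'⟩
  have hfin : c₃ * (c₂ + 1) ≠ ∞ := ENNReal.mul_ne_top hc₃' (ENNReal.add_ne_top.2 ⟨hc₂', by simp⟩)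
  refine ⟨(c₃ * (c₂ + 1)).toNNReal, ?_⟩
  intro X ℛ m μ _ 𝒢 ℋ N hN hC K f hf
  rw [ENNReal.coe_toNNReal hfin]
  set a : ℕ → X → ℝ≥0∞ := fun n => condLExp (𝒢 n) μ (f n) with ha
  have ham : ∀ n, Measurable (a n) := fun n => measurable_condLExp' _ _ _
  set F : X → ℝ≥0∞ := fun y => ∑ n ∈ Finset.range K, f n y with hFdef
  have hF : Measurable F := Finset.measurable_fun_sum _ fun k _ => hf k
  set G : X → ℝ≥0∞ := N F with hGdef
  have hG : Measurable G := hN.measurable' hF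
  set A : X → ℝ≥0∞ := fun y => ∑ n ∈ Finset.range K, a n y with hAdef
  have hA : Measurable A := Finset.measurable_fun_sum _ fun k _ => ham k
  set Φ : X → ℝ≥0∞ := N A with hΦdef
  have hΦ : Measurable Φ := hN.measurable' hA
  -- The maximal function is kept above ε = η^(1/q), so that its negative powers are finite; η then
  -- tends to 0.
  suffices h : ∀ η : ℝ≥0, 0 < η →
      ∫⁻ x, Φ x ^ q ∂μ ≤ c₃ * (η + (c₂ + 1) * ∫⁻ x, G x ^ q ∂μ) by
    have hc₃0 : c₃ ≠ 0 := by rw [hc₃]; simp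
    rw [mul_assoc]
    refine (ENNReal.div_le_iff_le_mul (Or.inl hc₃0) (Or.inl hc₃')).1 ?_ |>.trans_eq (mul_comm _ _)
    refine ENNReal.le_of_forall_pos_le_add fun η hη _ => ?_
    refine (ENNReal.div_le_iff_le_mul (Or.inl hc₃0) (Or.inl hc₃')).2 ?_
    rw [mul_comm, add_comm]
    exact h η hη
  intro η hη
  set ε : ℝ≥0∞ := (η : ℝ≥0∞) ^ q⁻¹ with hε
  have hεq : ε ^ q = η := ENNReal.rpow_inv_rpow hq0.ne' _
  have hε0 : 0 < ε := ENNReal.rpow_pos (by exact_mod_cast hη) (by simp)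
  have hεtop : ε ≠ ∞ := ENNReal.rpow_ne_top_of_nonneg (by positivity) (by simp)
  -- Chosen so that (D^s Φ)^r = D^(q-r) Φ^r, while D^s D is at most D^(q/r), whose r-th power is
  -- D^q.
  set s : ℝ := (q - r) / r with hs
  have hs0 : s ≤ 0 := div_nonpos_of_nonpos_of_nonneg (by linarith) hr0.le
  have hs1 : s + 1 = q / r := by rw [hs]; field_simp; ring
  have hs1' : 0 < s + 1 := by rw [hs1]; positivity
  have hsr : s * r = q - r := by rw [hs]; field_simp
  -- From time K on, `G` itself enters the maximum, so that `D K` dominates `G`.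
  let U : ℕ → X → ℝ≥0∞ := fun n => if n < K then condLExp (ℋ n) μ G else G
  have hU : ∀ n, Measurable (U n) := by
    intro n
    by_cases hn : n < K
    · simp only [U, hn, if_true]; exact measurable_condLExp' _ _ _
    · simp only [U, hn, if_false]; exact hG
  have hUR : ∀ n, Measurable[ℛ] (U n) := by
    intro n
    by_cases hn : n < K
    · simp only [U, hn, if_true]
      exact (measurable_condLExp _ _ _).mono (hN.le_range n) le_rfl
    · simp only [U, hn, if_false]; exact hN.measurable hF
  let D : ℕ → X → ℝ≥0∞ := fun n x => max ε (runMax U (n + 1) x)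
  have hDε : ∀ n x, ε ≤ D n x := fun n x => le_max_left _ _
  have hD0 : ∀ n x, D n x ≠ 0 := fun n x => (hε0.trans_le (hDε n x)).ne'
  have hDmono : ∀ {i j}, i ≤ j → ∀ x, D i x ≤ D j x := fun hij x =>
    max_le_max le_rfl (runMax_mono U (by omega) x)
  have hUD : ∀ n x, U n x ≤ D n x := fun n x => (le_runMax U n.lt_succ_self x).trans (le_max_right _ _)
  have hDR : ∀ n, Measurable[ℛ] (D n) := fun n =>
    measurable_const.max (@measurable_runMax _ ℛ _ _ fun k _ => hUR k)
  have hDH : ∀ n < K, Measurable[ℋ n] (D n) := by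
    intro n hn
    refine measurable_const.max (@measurable_runMax _ (ℋ n) _ _ fun k hk => ?_)
    simp only [U, (by omega : k < K), if_true]
    exact (measurable_condLExp _ _ _).mono (ℋ.mono (by omega)) le_rfl
  have hDm : ∀ n, Measurable (D n) := fun n => (hDR n).mono hN.range_le le_rfl
  let w : ℕ → X → ℝ≥0∞ := fun n x => D n x ^ s
  have hwR : ∀ n, Measurable[ℛ] (w n) := fun n => (hDR n).pow_const _
  have hwm : ∀ n, Measurable (w n) := fun n => (hDm n).pow_const _
  have hwanti : ∀ {i j}, i ≤ j → ∀ x, w j x ≤ w i x := fun hij x =>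
    rpow_le_rpow_of_nonpos hs0 (hDmono hij x)
  have hwD : ∀ n x, w n x * D n x ≤ D n x ^ (q / r) := fun n x => by
    rw [← hs1]; exact rpow_mul_self_le hs1' (hD0 n x)
  let δ : ℕ → X → ℝ≥0∞ := fun n x => w n x - w (n + 1) x
  have hδR : ∀ n, Measurable[ℛ] (δ n) := fun n => (hwR n).sub (hwR (n + 1))
  have hδm : ∀ n, Measurable (δ n) := fun n => (hδR n).mono hN.range_le le_rfl
  have htel : ∀ n ≤ K, ∀ x, w K x + ∑ k ∈ Finset.Ico n K, δ k x = w n x := by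
    intro n hn x
    induction hn using Nat.decreasingInduction with
    | self => simp
    | of_succ n hn ih =>
      rw [Finset.sum_eq_sum_Ico_succ_bot hn, add_left_comm, ih]
      exact tsub_add_cancel_of_le (hwanti n.le_succ x)
  -- Abel summation w_n = w_K + ∑ δ_k, with E_k inserted in the terms k ≥ n. This leaves E_n f'_n =
  -- w_n E_n f_n unchanged by the tower property. Without the E_k, the natural bound for ∑ w_n f_n
  -- would be w_0 F; with them, Garsia–Neveu applies.
  let f' : ℕ → X → ℝ≥0∞ := fun n x =>
    w K x * f n x + ∑ k ∈ Finset.Ico n K, condLExp (𝒢 k) μ (fun y => δ k y * f n y) x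
  have hf' : ∀ n, Measurable (f' n) := fun n => ((hwm K).mul (hf n)).add
    (Finset.measurable_fun_sum _ fun k _ => measurable_condLExp' _ _ _)
  have hcond : ∀ n < K, (fun x => w n x * a n x) =ᵐ[μ] condLExp (𝒢 n) μ (f' n) := by
    intro n hn
    have hwn : Measurable[𝒢 n] (w n) := ((hDH n hn).pow_const _).mono (hN.le n) le_rfl
    refine (condLExp_mul_left (𝒢.le n) hwn (hf n)).symm.trans ?_
    refine ae_eq_condLExp (𝒢.le n) μ _ (measurable_condLExp _ _ _) fun t ht => ?_
    rw [setLIntegral_condLExp (𝒢.le n) μ _ ht]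
    simp only [f']
    rw [lintegral_add_left ((hwm K).fun_mul (hf n)),
      lintegral_finsetSum _ fun k _ => measurable_condLExp' _ _ _]
    have h1 : ∀ k ∈ Finset.Ico n K,
        ∫⁻ x in t, condLExp (𝒢 k) μ (fun y => δ k y * f n y) x ∂μ =
          ∫⁻ x in t, δ k x * f n x ∂μ := fun k hk =>
      setLIntegral_condLExp (𝒢.le k) μ _ (𝒢.mono (Finset.mem_Ico.1 hk).1 t ht)
    rw [Finset.sum_congr rfl h1, ← lintegral_finsetSum _ fun k _ => (hδm k).fun_mul (hf n),
      ← lintegral_add_left ((hwm K).fun_mul (hf n))]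
    refine lintegral_congr fun x => ?_
    rw [← Finset.sum_mul, ← add_mul, htel n hn.le]
  let Z : ℕ → X → ℝ≥0∞ := fun n x =>
    ∑ k ∈ Finset.range n, condLExp (ℋ k) μ (fun y => δ k y * G y) x
  have hZm : ∀ n, Measurable (Z n) := fun n =>
    Finset.measurable_fun_sum _ fun k _ => measurable_condLExp' _ _ _
  have hsum : N (fun y => ∑ n ∈ Finset.range K, f' n y) ≤ᵐ[μ] fun x => w K x * G x + Z K x := by
    let B : ℕ → X → ℝ≥0∞ := fun k => condLExp (𝒢 k) μ (fun y => δ k y * F y)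
    have hB : ∀ k, Measurable (B k) := fun k => measurable_condLExp' _ _ _
    have hBsum : ∀ k, B k =ᵐ[μ]
        fun x => ∑ n ∈ Finset.range K, condLExp (𝒢 k) μ (fun y => δ k y * f n y) x := by
      intro k
      have := condLExp_finsetSum (P := μ) (𝒢 k) (Finset.range K) (X := fun n y => δ k y * f n y)
        fun n => ((hδm k).fun_mul (hf n)).aemeasurable
      have h2 : (∑ n ∈ Finset.range K, fun y => δ k y * f n y) = fun y => δ k y * F y := by
        funext y; simp [hFdef, Finset.mul_sum]
      rw [h2] at this
      filter_upwards [this] with x hx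
      simp only [B, hx, Finset.sum_apply]
    -- After exchanging the sums, the k-th term contains only f_n with n ≤ k; enlarging the inner
    -- sum to all n < K gives `F`.
    have h3 : (fun y => ∑ n ∈ Finset.range K, f' n y) ≤ᵐ[μ]
        fun y => w K y * F y + ∑ k ∈ Finset.range K, B k y := by
      filter_upwards [ae_all_iff.2 hBsum] with y hy
      simp only [f', Finset.sum_add_distrib, ← Finset.mul_sum]
      refine add_le_add le_rfl ?_
      rw [Finset.sum_congr rfl fun k _ => hy k, Finset.sum_comm (s := Finset.range K)]
      refine Finset.sum_le_sum fun n _ => Finset.sum_le_sum_of_subset ?_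
      intro k hk
      simp only [Finset.mem_Ico, Finset.mem_range] at hk ⊢
      exact hk.2
    have hBs : Measurable fun y => ∑ k ∈ Finset.range K, B k y :=
      Finset.measurable_fun_sum _ fun k _ => hB k
    have h4 := hN.mono_ae (Finset.measurable_fun_sum _ fun n _ => hf' n)
      (((hwm K).fun_mul hF).fun_add hBs) h3
    have h5 : ∀ k, N (B k) ≤ᵐ[μ] condLExp (ℋ k) μ (fun y => δ k y * G y) := by
      intro k
      have := hN.condLExp (n := k) ((hδm k).fun_mul hF)
      rwa [hN.mul (hδR k) hF] at this
    filter_upwards [h4, ae_all_iff.2 h5] with x hx hx5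
    refine hx.trans ((hN.add ((hwm K).fun_mul hF) hBs x).trans ?_)
    rw [hN.mul (hwR K) hF]
    refine add_le_add le_rfl ((hN.sum hB K x).trans ?_)
    exact Finset.sum_le_sum fun k _ => hx5 k
  have hZ : ∫⁻ x, Z K x ^ r ∂μ ≤ c₁ * ∫⁻ x, D K x ^ q ∂μ := by
    have := lintegral_rpow_le_of_forall_lintegral_mul_tsub_le (μ := μ) hr ℋ (Z := Z)
      (by funext x; simp [Z])
      (fun n => Finset.measurable_fun_sum _ fun k hk =>
        (measurable_condLExp _ _ _).mono (ℋ.mono (by simp at hk; omega)) le_rfl)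
      (monotone_nat_of_le_succ fun n x => by
        simp only [Z, Finset.sum_range_succ]; exact le_self_add)
      (W := fun x => D K x ^ (q / r)) ((hDm K).pow_const _) K ?_
    · simpa only [← ENNReal.rpow_mul, div_mul_cancel₀ _ hr0.ne'] using this
    -- The tail of δ_k telescopes to at most w_n, and θ w_n is `ℋ n`-measurable. Hence `G` may be
    -- replaced by E(G | ℋ_n) ≤ D_n, and w_n D_n ≤ D_n^(q/r).
    intro n hn θ hθ
    have hθm : Measurable θ := hθ.mono (ℋ.le n) le_rfl
    have hz : ∀ k, Measurable (condLExp (ℋ k) μ fun y => δ k y * G y) :=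
      fun k => measurable_condLExp' _ _ _
    calc ∫⁻ x, θ x * (Z K x - Z n x) ∂μ
        ≤ ∫⁻ x, ∑ k ∈ Finset.Ico n K, θ x * condLExp (ℋ k) μ (fun y => δ k y * G y) x ∂μ := by
          refine lintegral_mono fun x => ?_
          rw [← Finset.mul_sum]
          refine mul_le_mul' le_rfl ?_
          rw [tsub_le_iff_left]
          simp only [Z]
          rw [Finset.sum_range_add_sum_Ico _ hn.le]
      _ = ∑ k ∈ Finset.Ico n K, ∫⁻ x, θ x * condLExp (ℋ k) μ (fun y => δ k y * G y) x ∂μ :=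
          lintegral_finsetSum _ fun k _ => hθm.mul (hz k)
      _ = ∑ k ∈ Finset.Ico n K, ∫⁻ x, θ x * (δ k x * G x) ∂μ :=
          Finset.sum_congr rfl fun k hk => lintegral_mul_condLExp (ℋ.le k)
            (hθ.mono (ℋ.mono (Finset.mem_Ico.1 hk).1) le_rfl) ((hδm k).fun_mul hG)
      _ = ∫⁻ x, ∑ k ∈ Finset.Ico n K, θ x * (δ k x * G x) ∂μ :=
          (lintegral_finsetSum _ fun k _ => hθm.fun_mul ((hδm k).fun_mul hG)).symm
      _ ≤ ∫⁻ x, θ x * w n x * G x ∂μ := by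
          refine lintegral_mono fun x => ?_
          rw [← Finset.mul_sum, ← Finset.sum_mul, mul_assoc]
          refine mul_le_mul' le_rfl (mul_le_mul' ?_ le_rfl)
          rw [← htel n hn.le x]
          exact le_add_self
      _ = ∫⁻ x, θ x * w n x * condLExp (ℋ n) μ G x ∂μ :=
          (lintegral_mul_condLExp (ℋ.le n) (hθ.mul ((hDH n hn).pow_const _)) hG).symm
      _ ≤ ∫⁻ x, θ x * D K x ^ (q / r) ∂μ := by
          refine lintegral_mono fun x => ?_
          rw [mul_assoc]
          refine mul_le_mul' le_rfl ?_
          have hUn := hUD n x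
          simp only [U, hn, if_true] at hUn
          calc _ ≤ w n x * D n x := mul_le_mul' le_rfl hUn
            _ ≤ D n x ^ (q / r) := hwD n x
            _ ≤ _ := ENNReal.rpow_le_rpow (hDmono hn.le x) (by positivity)
  have hΦD : ∀ x, Φ x ^ q ≤ (w K x * Φ x) ^ r + D K x ^ q := by
    intro x
    rcases le_or_gt (Φ x) (D K x) with h | h
    · exact (ENNReal.rpow_le_rpow h hq0.le).trans le_add_self
    · refine le_trans ?_ le_self_add
      rw [ENNReal.mul_rpow_of_nonneg _ _ hr0.le]
      simp only [w]
      rw [← ENNReal.rpow_mul, hsr]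
      exact rpow_le_rpow_sub_mul_rpow hr0 hqr.le h
  have hwΦ : ∫⁻ x, (w K x * Φ x) ^ r ∂μ ≤
      C * (2 ^ (r - 1) * (1 + c₁)) * ∫⁻ x, D K x ^ q ∂μ := by
    calc ∫⁻ x, (w K x * Φ x) ^ r ∂μ
        ≤ ∫⁻ x, N (fun y => ∑ n ∈ Finset.range K, condLExp (𝒢 n) μ (f' n) y) x ^ r ∂μ := by
          refine lintegral_mono_ae ?_
          have h1 : (fun y => w K y * A y) ≤ᵐ[μ]
              fun y => ∑ n ∈ Finset.range K, condLExp (𝒢 n) μ (f' n) y := by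
            have : ∀ᵐ y ∂μ, ∀ n, n < K → w n y * a n y = condLExp (𝒢 n) μ (f' n) y :=
              ae_all_iff.2 fun n => by
                by_cases hn : n < K
                · filter_upwards [hcond n hn] with y hy _ using hy
                · exact Filter.Eventually.of_forall fun y h => absurd h hn
            filter_upwards [this] with y hy
            rw [hAdef, Finset.mul_sum]
            refine Finset.sum_le_sum fun n hn => ?_
            rw [Finset.mem_range] at hn
            rw [← hy n hn]
            exact mul_le_mul' (hwanti hn.le y) le_rfl
          have h2 := hN.mono_ae ((hwm K).fun_mul hA)
            (Finset.measurable_fun_sum _ fun n _ => measurable_condLExp' _ _ _) h1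
          rw [hN.mul (hwR K) hA] at h2
          filter_upwards [h2] with x hx using ENNReal.rpow_le_rpow hx hr0.le
      _ ≤ C * ∫⁻ x, N (fun y => ∑ n ∈ Finset.range K, f' n y) x ^ r ∂μ := hC K f' hf'
      _ ≤ C * ∫⁻ x, 2 ^ (r - 1) * (D K x ^ q + Z K x ^ r) ∂μ := by
          refine mul_le_mul' le_rfl (lintegral_mono_ae ?_)
          filter_upwards [hsum] with x hx
          refine (ENNReal.rpow_le_rpow hx hr0.le).trans
            ((ENNReal.rpow_add_le_mul_rpow_add_rpow _ _ hr.le).trans ?_)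
          refine mul_le_mul' le_rfl (add_le_add ?_ le_rfl)
          have hGD := hUD K x
          simp only [U, lt_irrefl, if_false] at hGD
          calc (w K x * G x) ^ r ≤ (D K x ^ (q / r)) ^ r :=
                ENNReal.rpow_le_rpow ((mul_le_mul' le_rfl hGD).trans (hwD K x)) hr0.le
            _ = D K x ^ q := by rw [← ENNReal.rpow_mul, div_mul_cancel₀ _ hr0.ne']
      _ = C * (2 ^ (r - 1) * (∫⁻ x, D K x ^ q ∂μ + ∫⁻ x, Z K x ^ r ∂μ)) := by
          rw [lintegral_const_mul _ (((hDm K).pow_const _).fun_add ((hZm K).pow_const _)),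
            lintegral_add_left ((hDm K).pow_const _)]
      _ ≤ C * (2 ^ (r - 1) * (∫⁻ x, D K x ^ q ∂μ + c₁ * ∫⁻ x, D K x ^ q ∂μ)) := by gcongr
      _ = _ := by ring
  have hDint : ∫⁻ x, D K x ^ q ∂μ ≤ η + (c₂ + 1) * ∫⁻ x, G x ^ q ∂μ := by
    have hrun : runMax U K = runMax (fun n => condLExp (ℋ n) μ G) K :=
      runMax_congr fun n hn => by simp [U, hn]
    have hRm : Measurable (runMax U K) := measurable_runMax fun n _ => hU n
    calc ∫⁻ x, D K x ^ q ∂μ ≤ ∫⁻ x, (ε ^ q + (runMax U K x ^ q + G x ^ q)) ∂μ := by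
          refine lintegral_mono fun x => ?_
          have hD : D K x = max ε (max (runMax U K x) (G x)) := by simp [D, runMax, U]
          rw [hD, (ENNReal.monotone_rpow_of_nonneg hq0.le).map_max,
            (ENNReal.monotone_rpow_of_nonneg hq0.le).map_max]
          refine (max_le_add_of_nonneg (by simp) (by simp)).trans ?_
          exact add_le_add le_rfl (max_le_add_of_nonneg (by simp) (by simp))
      _ = η + (∫⁻ x, runMax U K x ^ q ∂μ + ∫⁻ x, G x ^ q ∂μ) := by
          rw [lintegral_add_left measurable_const, lintegral_add_left (hRm.pow_const _)]
          simp [hεq]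
      _ ≤ η + (c₂ * ∫⁻ x, G x ^ q ∂μ + ∫⁻ x, G x ^ q ∂μ) := by
          refine add_le_add le_rfl (add_le_add ?_ le_rfl)
          rw [hrun]
          exact lintegral_runMax_rpow_le hq ℋ hG K
      _ = _ := by ring
  calc ∫⁻ x, Φ x ^ q ∂μ ≤ ∫⁻ x, ((w K x * Φ x) ^ r + D K x ^ q) ∂μ := lintegral_mono hΦD
    _ = ∫⁻ x, (w K x * Φ x) ^ r ∂μ + ∫⁻ x, D K x ^ q ∂μ :=
        lintegral_add_left (((hwm K).fun_mul hΦ).pow_const _) _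
    _ ≤ C * (2 ^ (r - 1) * (1 + c₁)) * ∫⁻ x, D K x ^ q ∂μ + ∫⁻ x, D K x ^ q ∂μ := by gcongr
    _ = c₃ * ∫⁻ x, D K x ^ q ∂μ := by rw [hc₃]; ring
    _ ≤ _ := by gcongr

/-- If `SumBound` holds for one exponent in `[1, ∞)`, then it holds for all exponents in
`(1, ∞)`. -/
theorem exists_sumBound {r q : ℝ} (hr : 1 ≤ r) (hq : 1 < q) (C : ℝ≥0) :
    ∃ C' : ℝ≥0, ∀ {X : Type u} {ℛ m : MeasurableSpace X} {μ : Measure X}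
      [IsProbabilityMeasure μ] {𝒢 ℋ : Filtration ℕ m} {N : (X → ℝ≥0∞) → X → ℝ≥0∞},
      IsPartialNorm ℛ μ 𝒢 ℋ N → SumBound μ 𝒢 N r C → SumBound μ 𝒢 N q C' := by
  rcases lt_trichotomy r q with h | rfl | h
  · exact exists_sumBound_of_lt hr h C
  · exact ⟨C, fun _ h => h⟩
  · exact exists_sumBound_of_gt hq h C

/-! ### Averaging over one coordinate of a product space -/

section Avg

variable {ι : Type} {Ω : ι → Type u}

theorem pi_mono {a b : (i : ι) → MeasurableSpace (Ω i)} (h : ∀ i, a i ≤ b i) :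
    (MeasurableSpace.pi (m := a)) ≤ MeasurableSpace.pi (m := b) :=
  iSup_mono fun i => MeasurableSpace.comap_mono (h i)

variable [DecidableEq ι]

theorem update_bot_le (a : (i : ι) → MeasurableSpace (Ω i)) (k i : ι) :
    Function.update a k ⊥ i ≤ a i := by
  rcases eq_or_ne i k with rfl | h
  · simp
  · simp [h]

/-- A function that is measurable with respect to the trivial σ-algebra in one coordinate does not
depend on this coordinate. -/
theorem apply_update_of_measurable {a : (i : ι) → MeasurableSpace (Ω i)} {k : ι}
    {θ : ((i : ι) → Ω i) → ℝ≥0∞}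
    (hθ : Measurable[MeasurableSpace.pi (m := Function.update a k ⊥)] θ)
    (x : (i : ι) → Ω i) (t : Ω k) : θ (Function.update x k t) = θ x := by
  -- The sets insensitive to coordinate `k` form a σ-algebra, so it suffices to check the generating
  -- cylinders.
  let T : MeasurableSpace ((i : ι) → Ω i) :=
    { MeasurableSet' := fun S => ∀ x t, Function.update x k t ∈ S ↔ x ∈ S
      measurableSet_empty := by simp
      measurableSet_compl := fun S hS x t => not_congr (hS x t)
      measurableSet_iUnion := fun S hS x t => by simp [hS _ x t] }
  have hle : MeasurableSpace.pi (m := Function.update a k ⊥) ≤ T := by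
    refine iSup_le fun j => ?_
    rintro _ ⟨S, hS, rfl⟩ x t
    rcases eq_or_ne j k with rfl | h
    · rw [Function.update_self] at hS
      rcases MeasurableSpace.measurableSet_bot_iff.1 hS with rfl | rfl <;> simp
    · simp [h]
  have := hle _ (hθ (measurableSet_singleton (θ x))) x t
  exact this.2 rfl

variable {a : (i : ι) → MeasurableSpace (Ω i)} [m : (i : ι) → MeasurableSpace (Ω i)] (P : (i : ι) → Measure (Ω i))

/-- The integral with respect to one coordinate. -/
def avg (k : ι) (f : ((i : ι) → Ω i) → ℝ≥0∞) (x : (i : ι) → Ω i) : ℝ≥0∞ :=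
  ∫⁻ t, f (Function.update x k t) ∂P k

/-- The `L_p`-norm with respect to one coordinate. -/
def partialLp (k : ι) (p : ℝ) (f : ((i : ι) → Ω i) → ℝ≥0∞) (x : (i : ι) → Ω i) : ℝ≥0∞ :=
  avg P k (fun y => f y ^ p) x ^ p⁻¹

variable {P}

theorem measurable_comp_update {f : ((i : ι) → Ω i) → ℝ≥0∞} (hf : Measurable f)
    (x : (i : ι) → Ω i) (k : ι) : Measurable fun t => f (Function.update x k t) :=
  hf.comp (measurable_update x)

theorem avg_mul {k : ι} {θ f : ((i : ι) → Ω i) → ℝ≥0∞}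
    (hθ : Measurable[MeasurableSpace.pi (m := Function.update a k ⊥)] θ) (hf : Measurable f) :
    avg P k (fun x => θ x * f x) = fun x => θ x * avg P k f x := by
  funext x
  simp only [avg, apply_update_of_measurable hθ]
  exact lintegral_const_mul _ (measurable_comp_update hf x k)

theorem avg_mono {f g : ((i : ι) → Ω i) → ℝ≥0∞} (h : f ≤ g) (k : ι) : avg P k f ≤ avg P k g :=
  fun _ => lintegral_mono fun _ => h _

theorem partialLp_mono {f g : ((i : ι) → Ω i) → ℝ≥0∞} {p : ℝ} (hp : 0 ≤ p) (h : f ≤ g) (k : ι) :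
    partialLp P k p f ≤ partialLp P k p g := fun x =>
  ENNReal.rpow_le_rpow (avg_mono (fun y => ENNReal.rpow_le_rpow (h y) hp) k x) (by positivity)

theorem partialLp_rpow {k : ι} {p : ℝ} (hp : 0 < p) (f : ((i : ι) → Ω i) → ℝ≥0∞)
    (x : (i : ι) → Ω i) : partialLp P k p f x ^ p = avg P k (fun y => f y ^ p) x :=
  ENNReal.rpow_inv_rpow hp.ne' _

theorem partialLp_mul {k : ι} {p : ℝ} (hp : 0 < p)
    {θ f : ((i : ι) → Ω i) → ℝ≥0∞}
    (hθ : Measurable[MeasurableSpace.pi (m := Function.update a k ⊥)] θ) (hf : Measurable f) :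
    partialLp P k p (fun x => θ x * f x) = fun x => θ x * partialLp P k p f x := by
  funext x
  simp only [partialLp, ENNReal.mul_rpow_of_nonneg _ _ hp.le]
  rw [avg_mul (hθ.pow_const p) (hf.pow_const p), ENNReal.mul_rpow_of_nonneg _ _ (by positivity),
    ENNReal.rpow_rpow_inv hp.ne']

theorem partialLp_add {k : ι} {p : ℝ} (hp : 1 ≤ p) {f g : ((i : ι) → Ω i) → ℝ≥0∞}
    (hf : Measurable f) (hg : Measurable g) :
    partialLp P k p (fun x => f x + g x) ≤ fun x => partialLp P k p f x + partialLp P k p g x := by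
  intro x
  have := ENNReal.lintegral_Lp_add_le (μ := P k) (measurable_comp_update hf x k).aemeasurable
    (measurable_comp_update hg x k).aemeasurable hp
  simpa only [partialLp, avg, one_div, Pi.add_apply] using this

theorem partialLp_iSup {k : ι} {p : ℝ} (hp : 0 < p) {f : ℕ → ((i : ι) → Ω i) → ℝ≥0∞}
    (hf : ∀ n, Measurable (f n)) (hmono : Monotone f) (x : (i : ι) → Ω i) :
    partialLp P k p (fun y => ⨆ n, f n y) x = ⨆ n, partialLp P k p (f n) x := by
  have h1 := (ENNReal.orderIsoRpow p⁻¹ (by positivity)).map_iSup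
    (fun n => avg P k (fun y => f n y ^ p) x)
  simp only [ENNReal.orderIsoRpow_apply] at h1
  simp only [partialLp]
  rw [← h1]
  congr 1
  simp only [avg]
  rw [← lintegral_iSup (fun n => (measurable_comp_update (hf n) x k).pow_const p)
    (fun i j hij t => ENNReal.rpow_le_rpow (hmono hij _) hp.le)]
  refine lintegral_congr fun t => ?_
  have h2 := (ENNReal.orderIsoRpow p hp).map_iSup (fun n => f n (Function.update x k t))
  simpa only [ENNReal.orderIsoRpow_apply] using h2

variable [∀ i, IsProbabilityMeasure (P i)]

theorem measurable_avg (ha : ∀ i, a i ≤ m i) {k : ι}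
    {f : ((i : ι) → Ω i) → ℝ≥0∞} (hf : Measurable[MeasurableSpace.pi (m := a)] f) :
    Measurable[MeasurableSpace.pi (m := Function.update a k ⊥)] (avg P k f) := by
  let m₁ : MeasurableSpace ((i : ι) → Ω i) := MeasurableSpace.pi (m := Function.update a k ⊥)
  -- The averaged coordinate carries the full σ-algebra `m k`, on which `P k` lives; the other
  -- coordinates keep that of `a`.
  have hupd : @Measurable _ _ (@Prod.instMeasurableSpace _ _ m₁ (m k))
      (MeasurableSpace.pi (m := a)) (fun z : ((i : ι) → Ω i) × Ω k =>
        Function.update z.1 k z.2) := by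
    refine @measurable_pi_lambda _ _ _ _ a _ fun j => ?_
    rcases eq_or_ne j k with rfl | h
    · simp only [Function.update_self]
      exact (@measurable_snd _ _ m₁ (m j)).mono le_rfl (ha j)
    · simp only [Function.update_of_ne h]
      have h1 : @Measurable _ _ m₁ (a j) (fun x : (i : ι) → Ω i => x j) := by
        have := @measurable_pi_apply ι Ω (Function.update a k ⊥) j
        rwa [Function.update_of_ne h] at this
      exact h1.comp (@measurable_fst _ _ m₁ (m k))
  exact @Measurable.lintegral_prod_right' _ _ m₁ (m k) (P k) _ _ (hf.comp hupd)

theorem measurable_partialLp (ha : ∀ i, a i ≤ m i) {k : ι}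
    {p : ℝ} {f : ((i : ι) → Ω i) → ℝ≥0∞} (hf : Measurable[MeasurableSpace.pi (m := a)] f) :
    Measurable[MeasurableSpace.pi (m := Function.update a k ⊥)] (partialLp P k p f) :=
  (measurable_avg ha (hf.pow_const p)).pow_const _

theorem measurable_avg' {k : ι} {f : ((i : ι) → Ω i) → ℝ≥0∞} (hf : Measurable f) :
    Measurable (avg P k f) :=
  (measurable_avg (fun _ => le_rfl) hf).mono (pi_mono (update_bot_le m k)) le_rfl

variable [Fintype ι]

theorem lintegral_avg {k : ι} {f : ((i : ι) → Ω i) → ℝ≥0∞} (hf : Measurable f) :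
    ∫⁻ x, avg P k f x ∂Measure.pi P = ∫⁻ x, f x ∂Measure.pi P := by
  obtain ⟨x⟩ := nonempty_of_isProbabilityMeasure (Measure.pi P)
  rw [lintegral_eq_lmarginal_univ x, lintegral_eq_lmarginal_univ x,
    lmarginal_erase' f hf (Finset.mem_univ k),
    lmarginal_erase' _ (measurable_avg' hf) (Finset.mem_univ k)]
  congr 2
  funext y
  simp [avg, Function.update_idem]

/-- By Fubini, almost every section of a null set in direction `k` is null. -/
theorem avg_congr_ae {k : ι} {f g : ((i : ι) → Ω i) → ℝ≥0∞} (hf : Measurable f)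
    (hg : Measurable g) (h : f =ᵐ[Measure.pi P] g) : avg P k f =ᵐ[Measure.pi P] avg P k g := by
  have hS : MeasurableSet {x | f x ≠ g x} := (measurableSet_eq_fun hf hg).compl
  have hI : Measurable (Set.indicator {x | f x ≠ g x} (1 : ((i : ι) → Ω i) → ℝ≥0∞)) :=
    measurable_one.indicator hS
  have h0 : ∫⁻ x, avg P k (Set.indicator {x | f x ≠ g x} 1) x ∂Measure.pi P = 0 := by
    rw [lintegral_avg hI, lintegral_indicator_one hS]
    exact ae_iff.1 h
  rw [lintegral_eq_zero_iff (measurable_avg' hI)] at h0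
  filter_upwards [h0] with x hx
  simp only [avg, Pi.zero_apply] at hx
  rw [lintegral_eq_zero_iff (measurable_comp_update hI x k)] at hx
  refine lintegral_congr_ae ?_
  filter_upwards [hx] with t ht
  by_contra hne
  simp [Set.indicator, hne] at ht

theorem partialLp_congr_ae {k : ι} {p : ℝ} {f g : ((i : ι) → Ω i) → ℝ≥0∞} (hf : Measurable f)
    (hg : Measurable g) (h : f =ᵐ[Measure.pi P] g) :
    partialLp P k p f =ᵐ[Measure.pi P] partialLp P k p g := by
  filter_upwards [avg_congr_ae (k := k) (hf.pow_const p) (hg.pow_const p)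
    (h.mono fun x hx => by simp only [hx])] with x hx
  simp only [partialLp, hx]

theorem lintegral_rpow_sub_one_mul_le {Y : Type*} [MeasurableSpace Y] (ν : Measure Y) {p : ℝ}
    (hp : 1 ≤ p) {f g : Y → ℝ≥0∞} (hf : Measurable f) (hg : Measurable g) :
    ∫⁻ y, f y ^ (p - 1) * g y ∂ν ≤
      ((∫⁻ y, f y ^ p ∂ν) ^ p⁻¹) ^ (p - 1) * (∫⁻ y, g y ^ p ∂ν) ^ p⁻¹ := by
  rcases hp.eq_or_lt with rfl | hp
  · simp
  have h := ENNReal.lintegral_mul_le_Lp_mul_Lq ν (Real.HolderConjugate.conjExponent hp).symm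
    (hf.pow_const (p - 1)).aemeasurable hg.aemeasurable
  have h1 : (p - 1) * p.conjExponent = p := by
    rw [Real.conjExponent, mul_div_cancel₀ _ (by linarith)]
  have h2 : 1 / p.conjExponent = p⁻¹ * (p - 1) := by
    rw [Real.conjExponent]; field_simp
  simp only [← ENNReal.rpow_mul, h1, h2, one_div, Pi.mul_apply] at h
  rw [← ENNReal.rpow_mul]
  exact h

/-- The conditional Minkowski inequality. -/
theorem partialLp_condLExp_le (ha : ∀ i, a i ≤ m i) {k : ι}
    {p : ℝ} (hp : 1 ≤ p) {g : ((i : ι) → Ω i) → ℝ≥0∞} (hg : Measurable g) :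
    partialLp P k p (condLExp (MeasurableSpace.pi (m := a)) (Measure.pi P) g)
      ≤ᵐ[Measure.pi P] condLExp (MeasurableSpace.pi (m := Function.update a k ⊥)) (Measure.pi P)
        (partialLp P k p g) := by
  have hp0 : 0 < p := by linarith
  set μ := Measure.pi P
  have hle : (MeasurableSpace.pi (m := a)) ≤ MeasurableSpace.pi (m := m) := pi_mono ha
  have hle' : (MeasurableSpace.pi (m := Function.update a k ⊥)) ≤ MeasurableSpace.pi (m := a) :=
    pi_mono (update_bot_le a k)
  set e := condLExp (MeasurableSpace.pi (m := a)) μ g with he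
  -- Truncation makes the partial norm `h` finite, so that h^(1-p) can be used; monotone convergence
  -- removes it at the end.
  let en : ℕ → ((i : ι) → Ω i) → ℝ≥0∞ := fun n x => min (e x) n
  have hen : ∀ n, Measurable[MeasurableSpace.pi (m := a)] (en n) := fun n =>
    (measurable_condLExp _ _ _).min measurable_const
  have henm : ∀ n, Measurable (en n) := fun n => (hen n).mono hle le_rfl
  have hsup : e = fun x => ⨆ n, en n x := by
    funext x
    simp only [en]
    rw [← inf_iSup_eq, ENNReal.iSup_natCast, inf_top_eq]
  have hTg : Measurable (partialLp P k p g) :=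
    (measurable_partialLp (fun _ => le_rfl) hg).mono (pi_mono (update_bot_le m k)) le_rfl
  have key : ∀ n, partialLp P k p (en n) ≤ᵐ[μ]
      condLExp (MeasurableSpace.pi (m := Function.update a k ⊥)) μ (partialLp P k p g) := by
    intro n
    set h := partialLp P k p (en n) with hh
    have hhm : Measurable[MeasurableSpace.pi (m := Function.update a k ⊥)] h :=
      measurable_partialLp ha (hen n)
    have hfin : ∀ x, h x ≠ ∞ := by
      intro x
      refine ne_top_of_le_ne_top (b := n) (by simp) ?_
      calc h x ≤ partialLp P k p (fun _ => (n : ℝ≥0∞)) x :=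
            partialLp_mono hp0.le (fun y => min_le_right _ _) k x
        _ = n := by simp [partialLp, avg, ENNReal.rpow_rpow_inv hp0.ne']
    refine le_condLExp (hle'.trans hle) hhm fun B hB => ?_
    -- The duality weight: h = h^(1-p) ∫ e_n^p in coordinate `k`. One factor e_n is bounded by e and
    -- exchanged for g, and Hölder in coordinate `k` yields h^(p-1), cancelling the weight.
    let κ : ((i : ι) → Ω i) → ℝ≥0∞ := B.indicator fun x => h x ^ (1 - p)
    have hκ : Measurable[MeasurableSpace.pi (m := Function.update a k ⊥)] κ :=
      (hhm.pow_const _).indicator hB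
    have hκm : Measurable κ := hκ.mono (hle'.trans hle) le_rfl
    rw [← lintegral_indicator ((hle'.trans hle) B hB),
      ← lintegral_indicator ((hle'.trans hle) B hB)]
    calc ∫⁻ x, B.indicator h x ∂μ
        ≤ ∫⁻ x, κ x * avg P k (fun y => en n y ^ p) x ∂μ := by
          refine lintegral_mono fun x => ?_
          by_cases hx : x ∈ B
          · simp only [κ, Set.indicator_of_mem hx]
            rw [← partialLp_rpow hp0, ← hh]
            rcases eq_or_ne (h x) 0 with h0 | h0
            · simp [h0]
            · rw [← ENNReal.rpow_add _ _ h0 (hfin x)]; simp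
          · simp [hx]
      _ = ∫⁻ x, κ x * en n x ^ p ∂μ := by
          have := avg_mul (P := P) hκ ((henm n).pow_const p)
          rw [← lintegral_avg (P := P) (k := k) (hκm.fun_mul ((henm n).pow_const p)), this]
      _ ≤ ∫⁻ x, κ x * en n x ^ (p - 1) * e x ∂μ := by
          refine lintegral_mono fun x => ?_
          rw [mul_assoc]
          refine mul_le_mul' le_rfl ?_
          calc en n x ^ p = en n x ^ (p - 1) * en n x ^ (1 : ℝ) := by
                rw [← ENNReal.rpow_add_of_nonneg _ _ (by linarith) zero_le_one]; simp
            _ ≤ _ := by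
                rw [ENNReal.rpow_one]
                exact mul_le_mul' le_rfl (min_le_left _ _)
      _ = ∫⁻ x, κ x * en n x ^ (p - 1) * g x ∂μ :=
          lintegral_mul_condLExp hle ((hκ.mono hle' le_rfl).mul ((hen n).pow_const _)) hg
      _ = ∫⁻ x, κ x * avg P k (fun y => en n y ^ (p - 1) * g y) x ∂μ := by
          have hm1 : Measurable fun y => en n y ^ (p - 1) * g y :=
            ((henm n).pow_const _).fun_mul hg
          simp_rw [mul_assoc]
          rw [← lintegral_avg (P := P) (k := k) (hκm.fun_mul hm1), avg_mul hκ hm1]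
      _ ≤ ∫⁻ x, κ x * (h x ^ (p - 1) * partialLp P k p g x) ∂μ := by
          refine lintegral_mono fun x => mul_le_mul' le_rfl ?_
          exact lintegral_rpow_sub_one_mul_le (P k) hp (measurable_comp_update (henm n) x k)
            (measurable_comp_update hg x k)
      _ ≤ ∫⁻ x, B.indicator (partialLp P k p g) x ∂μ := by
          refine lintegral_mono fun x => ?_
          by_cases hx : x ∈ B
          · simp only [κ, Set.indicator_of_mem hx]
            rw [← mul_assoc]
            refine mul_le_of_le_one_left zero_le ?_
            rcases eq_or_ne (h x) 0 with h0 | h0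
            · rcases hp.eq_or_lt with rfl | hp1
              · simp
              · rw [h0, ENNReal.zero_rpow_of_pos (by linarith : 0 < p - 1), mul_zero]
                exact zero_le_one
            · rw [← ENNReal.rpow_add _ _ h0 (hfin x)]; simp
          · simp [hx, κ]
  filter_upwards [ae_all_iff.2 key] with x hx
  have hmono : Monotone en := fun i j hij y => min_le_min_left _ (by exact_mod_cast hij)
  rw [hsup, partialLp_iSup hp0 henm hmono]
  exact iSup_le hx

theorem lintegral_partialLp_rpow {k : ι} {p : ℝ} (hp : 0 < p) {f : ((i : ι) → Ω i) → ℝ≥0∞}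
    (hf : Measurable f) :
    ∫⁻ x, partialLp P k p f x ^ p ∂Measure.pi P = ∫⁻ x, f x ^ p ∂Measure.pi P := by
  simp_rw [partialLp_rpow hp]
  exact lintegral_avg (hf.pow_const p)

end Avg

/-! ### Partial mixed norms -/

section PartialNorm

variable {d : ℕ} {Ω : Fin d → Type u}

/-- The family of σ-algebras that is trivial in the first `k` coordinates and agrees with `a` in the
other ones. -/
@[reducible]
def freeze (k : ℕ) (a : (i : Fin d) → MeasurableSpace (Ω i)) (i : Fin d) : MeasurableSpace (Ω i) :=
  if (i : ℕ) < k then ⊥ else a i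

theorem freeze_zero (a : (i : Fin d) → MeasurableSpace (Ω i)) : freeze 0 a = a := by
  funext i; simp [freeze]

theorem freeze_succ {k : ℕ} (h : k < d) (a : (i : Fin d) → MeasurableSpace (Ω i)) :
    freeze (k + 1) a = Function.update (freeze k a) ⟨k, h⟩ ⊥ := by
  funext i
  rcases eq_or_ne i ⟨k, h⟩ with rfl | hi
  · simp [freeze]
  · have : (i : ℕ) ≠ k := fun h' => hi (Fin.ext h')
    rw [Function.update_of_ne hi]
    simp only [freeze, (by omega : (i : ℕ) < k + 1 ↔ (i : ℕ) < k)]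

theorem freeze_succ_of_le {k : ℕ} (h : d ≤ k) (a : (i : Fin d) → MeasurableSpace (Ω i)) :
    freeze (k + 1) a = freeze k a := by
  funext i
  have := i.2
  simp only [freeze, (by omega : (i : ℕ) < k + 1 ↔ (i : ℕ) < k)]

theorem freeze_mono (k : ℕ) {a b : (i : Fin d) → MeasurableSpace (Ω i)} (h : ∀ i, a i ≤ b i)
    (i : Fin d) : freeze k a i ≤ freeze k b i := by
  unfold freeze; split_ifs
  · exact le_rfl
  · exact h i

theorem freeze_le (k : ℕ) (a : (i : Fin d) → MeasurableSpace (Ω i)) (i : Fin d) :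
    freeze k a i ≤ a i := by
  unfold freeze; split_ifs
  · exact bot_le
  · exact le_rfl

variable [m : (i : Fin d) → MeasurableSpace (Ω i)]

/-- The mixed norm in the first `k` variables. -/
def partialNorm (P : (i : Fin d) → Measure (Ω i)) (p : Fin d → ℝ) :
    ℕ → (((i : Fin d) → Ω i) → ℝ≥0∞) → ((i : Fin d) → Ω i) → ℝ≥0∞
  | 0, f => f
  | k + 1, f =>
      if h : k < d then partialLp P ⟨k, h⟩ (p ⟨k, h⟩) (partialNorm P p k f) else partialNorm P p k f

variable {P : (i : Fin d) → Measure (Ω i)} {p : Fin d → ℝ}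

theorem partialNorm_succ {k : ℕ} (h : k < d) (f : ((i : Fin d) → Ω i) → ℝ≥0∞) :
    partialNorm P p (k + 1) f = partialLp P ⟨k, h⟩ (p ⟨k, h⟩) (partialNorm P p k f) := by
  simp [partialNorm, h]

theorem partialNorm_succ_of_le {k : ℕ} (h : d ≤ k) :
    partialNorm P p (k + 1) = partialNorm P p k := by
  funext f
  simp [partialNorm, h.not_gt]

theorem partialNorm_mono (hp : ∀ i, 1 ≤ p i) {f g : ((i : Fin d) → Ω i) → ℝ≥0∞} (hfg : f ≤ g)
    (k : ℕ) : partialNorm P p k f ≤ partialNorm P p k g := by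
  induction k with
  | zero => exact hfg
  | succ k ih =>
    by_cases h : k < d
    · rw [partialNorm_succ h, partialNorm_succ h]
      exact partialLp_mono (zero_le_one.trans (hp _)) ih _
    · rwa [partialNorm_succ_of_le (not_lt.1 h)]

variable [∀ i, IsProbabilityMeasure (P i)]

theorem measurable_partialNorm {f : ((i : Fin d) → Ω i) → ℝ≥0∞} (hf : Measurable f) (k : ℕ) :
    Measurable (partialNorm P p k f) := by
  induction k with
  | zero => exact hf
  | succ k ih =>
    by_cases h : k < d
    · rw [partialNorm_succ h]
      exact (measurable_partialLp (fun _ => le_rfl) ih).mono (pi_mono (update_bot_le m _)) le_rfl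
    · rwa [partialNorm_succ_of_le (not_lt.1 h)]

theorem partialNorm_iSup (hp : ∀ i, 1 ≤ p i) {f : ℕ → ((i : Fin d) → Ω i) → ℝ≥0∞}
    (hf : ∀ n, Measurable (f n)) (hmono : Monotone f) (k : ℕ) :
    partialNorm P p k (fun y => ⨆ n, f n y) = fun x => ⨆ n, partialNorm P p k (f n) x := by
  induction k with
  | zero => rfl
  | succ k ih =>
    by_cases h : k < d
    · simp only [partialNorm_succ h, ih]
      funext x
      exact partialLp_iSup (zero_lt_one.trans_le (hp _)) (fun n => measurable_partialNorm (hf n) k)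
        (fun i j hij => partialNorm_mono hp (hmono hij) k) x
    · rwa [partialNorm_succ_of_le (not_lt.1 h)]

/-- The family of filtrations that is trivial in the first `k` coordinates and agrees with `ℱ` in
the other ones. -/
def freezeFiltration (k : ℕ) (ℱ : (i : Fin d) → Filtration ℕ (m i)) (i : Fin d) :
    Filtration ℕ (m i) :=
  if (i : ℕ) < k then Filtration.const ℕ ⊥ bot_le else ℱ i

theorem prodFiltration_freezeFiltration (k : ℕ) (ℱ : (i : Fin d) → Filtration ℕ (m i)) (n : ℕ) :
    prodFiltration (freezeFiltration k ℱ) n =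
      MeasurableSpace.pi (m := freeze k fun i => ℱ i n) := by
  change MeasurableSpace.pi (m := _) = _
  congr 1
  funext i
  by_cases h : (i : ℕ) < k <;> simp [freeze, freezeFiltration, h, Filtration.const]

theorem isPartialNorm_partialNorm (hp : ∀ i, 1 ≤ p i) (ℱ : (i : Fin d) → Filtration ℕ (m i))
    (k : ℕ) : IsPartialNorm (MeasurableSpace.pi (m := freeze k m)) (Measure.pi P)
      (prodFiltration ℱ) (prodFiltration (freezeFiltration k ℱ)) (partialNorm P p k) := by
  have hle : ∀ k n, prodFiltration (freezeFiltration k ℱ) n ≤ prodFiltration ℱ n := fun k n => by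
    rw [prodFiltration_freezeFiltration]
    exact pi_mono (freeze_le k _)
  have hle_range : ∀ k n, prodFiltration (freezeFiltration k ℱ) n ≤
      MeasurableSpace.pi (m := freeze k m) := fun k n => by
    rw [prodFiltration_freezeFiltration]
    exact pi_mono (freeze_mono k fun i => (ℱ i).le n)
  induction k with
  | zero =>
    have h0 : ∀ n, prodFiltration (freezeFiltration 0 ℱ) n = prodFiltration ℱ n := fun n => by
      rw [prodFiltration_freezeFiltration, freeze_zero]; rfl
    exact
      { le := hle 0
        le_range := hle_range 0
        range_le := pi_mono (freeze_le 0 m)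
        measurable := fun h => by rw [freeze_zero]; exact h
        adapted := fun {n f} h => by rw [h0 n]; exact h
        mul := fun _ _ => rfl
        mono := fun h => h
        add := fun _ _ => le_rfl
        congr := fun _ _ h => h
        condLExp := fun {n f} _ => by rw [h0 n]; exact Filter.EventuallyLE.rfl }
  | succ k hN =>
    by_cases h : k < d
    swap
    · have hk := not_lt.1 h
      have h1 : freezeFiltration (k + 1) ℱ = freezeFiltration k ℱ := by
        funext i
        have := i.2
        simp only [freezeFiltration, (by omega : (i : ℕ) < k + 1 ↔ (i : ℕ) < k)]
      rw [partialNorm_succ_of_le hk, freeze_succ_of_le hk, h1]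
      exact hN
    set j : Fin d := ⟨k, h⟩
    have hpj : 0 < p j := zero_lt_one.trans_le (hp j)
    have hm : ∀ i, freeze k m i ≤ m i := freeze_le k m
    have hℱm : ∀ n i, freeze k (fun i => ℱ i n) i ≤ m i := fun n i =>
      (freeze_le k _ i).trans ((ℱ i).le n)
    have hpf : ∀ n, prodFiltration (freezeFiltration (k + 1) ℱ) n =
        MeasurableSpace.pi (m := Function.update (freeze k fun i => ℱ i n) j ⊥) := fun n => by
      rw [prodFiltration_freezeFiltration, freeze_succ h]
    have hpf' : ∀ n, prodFiltration (freezeFiltration k ℱ) n =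
        MeasurableSpace.pi (m := freeze k fun i => ℱ i n) :=
      prodFiltration_freezeFiltration k ℱ
    exact
      { le := hle (k + 1)
        le_range := hle_range (k + 1)
        range_le := pi_mono (freeze_le (k + 1) m)
        measurable := fun hf => by
          rw [partialNorm_succ h, freeze_succ h]
          exact measurable_partialLp hm (hN.measurable hf)
        adapted := fun {n f} hf => by
          rw [partialNorm_succ h, hpf n]
          exact measurable_partialLp (hℱm n) (hpf' n ▸ hN.adapted hf)
        mul := fun {θ f} hθ hf => by
          rw [freeze_succ h] at hθ
          rw [partialNorm_succ h, partialNorm_succ h,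
            hN.mul (hθ.mono (pi_mono (update_bot_le _ j)) le_rfl) hf]
          exact partialLp_mul hpj hθ (hN.measurable' hf)
        mono := fun hfg => partialNorm_mono hp hfg (k + 1)
        add := fun {f g} hf hg => by
          simp only [partialNorm_succ h]
          exact (partialLp_mono hpj.le (hN.add hf hg) j).trans
            (partialLp_add (hp j) (hN.measurable' hf) (hN.measurable' hg))
        congr := fun hf hg hfg => by
          simp only [partialNorm_succ h]
          exact partialLp_congr_ae (hN.measurable' hf) (hN.measurable' hg) (hN.congr hf hg hfg)
        condLExp := fun {n f} hf => by
          rw [partialNorm_succ h, partialNorm_succ h, hpf n]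
          have hmf := hN.measurable' (measurable_condLExp' (prodFiltration ℱ n) (Measure.pi P) f)
          have h1 := hN.condLExp (n := n) hf
          have h2 : Measurable (MeasureTheory.condLExp (prodFiltration (freezeFiltration k ℱ) n) (Measure.pi P)
            (partialNorm P p k f)) := measurable_condLExp' _ _ _
          -- The inductive inequality holds only almost everywhere; replacing the left side by the
          -- minimum of both makes it pointwise, as monotonicity requires.
          have h3 := partialLp_congr_ae (k := j) (p := p j) hmf (hmf.min h2)
            (h1.mono fun x hx => (min_eq_left hx).symm)
          have h4 := partialLp_mono (P := P) hpj.le (k := j)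
            (fun x => min_le_right (partialNorm P p k
              (MeasureTheory.condLExp (prodFiltration ℱ n) (Measure.pi P) f) x)
              (MeasureTheory.condLExp (prodFiltration (freezeFiltration k ℱ) n) (Measure.pi P)
                (partialNorm P p k f) x))
          have h5 := partialLp_condLExp_le (P := P) (hℱm n) (k := j) (hp j) (hN.measurable' hf)
          rw [hpf' n] at h3 h4
          filter_upwards [h3, h5] with x hx3 hx5
          rw [hx3]
          exact (h4 x).trans hx5 }

theorem SumBound.partialNorm_succ {ℱ : (i : Fin d) → Filtration ℕ (m i)} {k : ℕ} (h : k < d)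
    (hp : 0 < p ⟨k, h⟩) {C : ℝ≥0}
    (hC : SumBound (Measure.pi P) (prodFiltration ℱ) (partialNorm P p k) (p ⟨k, h⟩) C) :
    SumBound (Measure.pi P) (prodFiltration ℱ) (partialNorm P p (k + 1)) (p ⟨k, h⟩) C := by
  intro K f hf
  simp only [MixedMartingale.partialNorm_succ h]
  rw [lintegral_partialLp_rpow hp (measurable_partialNorm
      (Finset.measurable_fun_sum _ fun n _ => measurable_condLExp' _ _ _) k),
    lintegral_partialLp_rpow hp (measurable_partialNorm
      (Finset.measurable_fun_sum _ fun n _ => hf n) k)]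
  exact hC K f hf

end PartialNorm

/-- The sum inequality for the partial mixed norms, when the exponents equal to `1` come first. -/
theorem exists_sumBound_partialNorm {d : ℕ} {p : Fin d → ℝ} (hp : ∀ i, 1 ≤ p i)
    (hlead : ∀ i, p i = 1 → ∀ j < i, p j = 1) (k : ℕ) :
    (∀ q : ℝ, 1 < q → ∃ C : ℝ≥0, ∀ (Ω : Fin d → Type u) [m : (i : Fin d) → MeasurableSpace (Ω i)]
      (P : (i : Fin d) → Measure (Ω i)) [∀ i, IsProbabilityMeasure (P i)]
      (ℱ : (i : Fin d) → Filtration ℕ (m i)),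
      SumBound (Measure.pi P) (prodFiltration ℱ) (partialNorm P p k) q C) ∧
    ((∀ j : Fin d, (j : ℕ) < k → p j = 1) →
      ∀ (Ω : Fin d → Type u) [m : (i : Fin d) → MeasurableSpace (Ω i)]
      (P : (i : Fin d) → Measure (Ω i)) [∀ i, IsProbabilityMeasure (P i)]
      (ℱ : (i : Fin d) → Filtration ℕ (m i)),
      SumBound (Measure.pi P) (prodFiltration ℱ) (partialNorm P p k) 1 1) := by
  -- The constant is chosen before the spaces and filtrations, so it depends only on the exponents.
  have extrapolate : ∀ (k : ℕ) (r : ℝ) (C : ℝ≥0), 1 ≤ r →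
      (∀ (Ω : Fin d → Type u) [m : (i : Fin d) → MeasurableSpace (Ω i)]
        (P : (i : Fin d) → Measure (Ω i)) [∀ i, IsProbabilityMeasure (P i)]
        (ℱ : (i : Fin d) → Filtration ℕ (m i)),
        SumBound (Measure.pi P) (prodFiltration ℱ) (partialNorm P p k) r C) →
      ∀ q : ℝ, 1 < q → ∃ C : ℝ≥0, ∀ (Ω : Fin d → Type u)
        [m : (i : Fin d) → MeasurableSpace (Ω i)]
        (P : (i : Fin d) → Measure (Ω i)) [∀ i, IsProbabilityMeasure (P i)]
        (ℱ : (i : Fin d) → Filtration ℕ (m i)),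
        SumBound (Measure.pi P) (prodFiltration ℱ) (partialNorm P p k) q C := by
    intro k r C hr h q hq
    obtain ⟨C', hC'⟩ := exists_sumBound.{u} hr hq C
    refine ⟨C', fun Ω m P _ ℱ => ?_⟩
    exact hC' (isPartialNorm_partialNorm hp ℱ k) (h Ω P ℱ)
  induction k with
  | zero =>
    have h1 : ∀ (Ω : Fin d → Type u) [m : (i : Fin d) → MeasurableSpace (Ω i)]
        (P : (i : Fin d) → Measure (Ω i)) [∀ i, IsProbabilityMeasure (P i)]
        (ℱ : (i : Fin d) → Filtration ℕ (m i)),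
        SumBound (Measure.pi P) (prodFiltration ℱ) (partialNorm P p 0) 1 1 := by
      intro Ω m P _ ℱ K f hf
      simp only [partialNorm, ENNReal.rpow_one, ENNReal.coe_one, one_mul]
      rw [lintegral_finsetSum _ fun n _ => measurable_condLExp' _ _ _,
        lintegral_finsetSum _ fun n _ => hf n]
      exact (Finset.sum_congr rfl fun n _ => lintegral_condLExp ((prodFiltration ℱ).le n) _ _).le
    exact ⟨extrapolate 0 1 1 le_rfl h1, fun _ => h1⟩
  | succ k ih =>
    by_cases h : k < d
    swap
    · simp only [partialNorm_succ_of_le (not_lt.1 h)]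
      exact ⟨ih.1, fun hj => ih.2 fun j hjk => hj j (hjk.trans k.lt_succ_self)⟩
    set i : Fin d := ⟨k, h⟩ with hi
    have hpi : 0 < p i := zero_lt_one.trans_le (hp i)
    -- Here the Fubini step needs the previous bound at exponent 1 itself, which exists because all
    -- earlier exponents equal 1.
    have hone : p i = 1 → ∀ (Ω : Fin d → Type u) [m : (i : Fin d) → MeasurableSpace (Ω i)]
        (P : (i : Fin d) → Measure (Ω i)) [∀ i, IsProbabilityMeasure (P i)]
        (ℱ : (i : Fin d) → Filtration ℕ (m i)),
        SumBound (Measure.pi P) (prodFiltration ℱ) (partialNorm P p (k + 1)) 1 1 := by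
      intro hpi1 Ω m P _ ℱ
      have := SumBound.partialNorm_succ (P := P) (ℱ := ℱ) h hpi (C := 1)
      rw [← hi, hpi1] at this
      exact this (ih.2 (fun j hj => hlead i hpi1 j hj) Ω P ℱ)
    refine ⟨?_, fun hj => hone (hj i k.lt_succ_self)⟩
    rcases (hp i).eq_or_lt with hpi1 | hpi1
    · exact extrapolate _ 1 1 le_rfl (hone hpi1.symm)
    · obtain ⟨C, hC⟩ := ih.1 (p i) hpi1
      exact extrapolate _ (p i) C hpi1.le fun Ω m P _ ℱ =>
        SumBound.partialNorm_succ h hpi (hC Ω P ℱ)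

/-! ### Identification of the mixed norm -/

theorem eLpNorm_eq_lintegral_rpow {Y : Type*} [MeasurableSpace Y] (ν : Measure Y) {p : ℝ≥0∞}
    (h0 : p ≠ 0) (h1 : p ≠ ∞) (f : Y → ℝ≥0∞) :
    eLpNorm f p ν = (∫⁻ y, f y ^ p.toReal ∂ν) ^ p.toReal⁻¹ := by
  rw [eLpNorm_eq_lintegral_rpow_enorm_toReal h0 h1]
  simp

/-- `partialNorm` adds variables at the end while `mixedNorm` peels them off at the front; this
reconciles the two recursions. -/
theorem partialNorm_cons {d : ℕ} {Ω : Fin (d + 1) → Type u}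
    [m : (i : Fin (d + 1)) → MeasurableSpace (Ω i)] (P : (i : Fin (d + 1)) → Measure (Ω i))
    (p : Fin (d + 1) → ℝ) (f : ((i : Fin (d + 1)) → Ω i) → ℝ≥0∞) (x : Ω 0) (k : ℕ)
    (y : (i : Fin d) → Ω i.succ) :
    partialNorm P p (k + 1) f (Fin.cons x y) =
      partialNorm (fun i => P i.succ) (fun i => p i.succ) k
        (fun z => partialLp P 0 (p 0) f (Fin.cons x z)) y := by
  induction k generalizing y with
  | zero => rw [partialNorm_succ (Nat.succ_pos d)]; rfl
  | succ k ih =>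
    by_cases h : k < d
    · rw [partialNorm_succ (Nat.succ_lt_succ h), partialNorm_succ h]
      have hs : (⟨k + 1, Nat.succ_lt_succ h⟩ : Fin (d + 1)) = Fin.succ ⟨k, h⟩ := rfl
      rw [hs]
      simp only [partialLp, avg, ← Fin.cons_update, ih]
    · rw [partialNorm_succ_of_le (by omega : d + 1 ≤ k + 1), partialNorm_succ_of_le (not_lt.1 h), ih]

theorem partialNorm_eq_mixedNorm {d : ℕ} {Ω : Fin d → Type u}
    [m : (i : Fin d) → MeasurableSpace (Ω i)] (P : (i : Fin d) → Measure (Ω i))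
    {p : Fin d → ℝ≥0∞} (h0 : ∀ i, p i ≠ 0) (h1 : ∀ i, p i ≠ ∞)
    (f : ((i : Fin d) → Ω i) → ℝ≥0∞) (x : (i : Fin d) → Ω i) :
    partialNorm P (fun i => (p i).toReal) d f x = mixedNorm P p f := by
  induction d with
  | zero => exact congrArg f (Subsingleton.elim _ _)
  | succ d ih =>
    rw [← Fin.cons_self_tail x, partialNorm_cons, mixedNorm,
      ← ih (fun i => P i.succ) (fun i => h0 i.succ) (fun i => h1 i.succ) _ (Fin.tail x)]
    congr 1
    funext z
    rw [eLpNorm_eq_lintegral_rpow _ (h0 0) (h1 0)]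
    simp only [partialLp, avg, Fin.update_cons_zero]

theorem mixedNorm_rpow_half {d : ℕ} {Ω : Fin d → Type u}
    [m : (i : Fin d) → MeasurableSpace (Ω i)] (P : (i : Fin d) → Measure (Ω i))
    {p : Fin d → ℝ≥0∞} (h0 : ∀ i, p i ≠ 0) (h1 : ∀ i, p i ≠ ∞)
    (f : ((i : Fin d) → Ω i) → ℝ≥0∞) :
    mixedNorm P p (fun x => f x ^ (1 / 2 : ℝ)) =
      mixedNorm P (fun i => p i / 2) f ^ (1 / 2 : ℝ) := by
  induction d with
  | zero => rfl
  | succ d ih =>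
    simp only [mixedNorm]
    rw [← ih (fun i => P i.succ) (fun i => h0 i.succ) (fun i => h1 i.succ)]
    congr 1
    funext z
    have h2 : p 0 / 2 ≠ 0 := (ENNReal.half_pos (h0 0)).ne'
    have h3 : p 0 / 2 ≠ ∞ := (ENNReal.half_lt_self (h0 0) (h1 0)).ne_top
    rw [eLpNorm_eq_lintegral_rpow _ (h0 0) (h1 0), eLpNorm_eq_lintegral_rpow _ h2 h3]
    simp only [← ENNReal.rpow_mul, ENNReal.toReal_div, ENNReal.toReal_ofNat]
    congr 2
    · funext x; congr 1; ring
    · field_simp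

/-! ### Sums of conditional expectations and square functions in mixed norms -/

theorem exists_mixedNorm_tsum_condLExp_le {d : ℕ} {p : Fin d → ℝ≥0∞} (h1 : ∀ i, 1 ≤ p i)
    (htop : ∀ i, p i ≠ ∞) (hlead : ∀ i, p i = 1 → ∀ j < i, p j = 1) :
    ∃ c : ℝ≥0, ∀ (Ω : Fin d → Type u) [m : (i : Fin d) → MeasurableSpace (Ω i)]
      (P : (i : Fin d) → Measure (Ω i)) [∀ i, IsProbabilityMeasure (P i)]
      (ℱ : (i : Fin d) → Filtration ℕ (m i)) (f : ℕ → ((i : Fin d) → Ω i) → ℝ≥0∞),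
      (∀ n, Measurable (f n)) →
      mixedNorm P p (fun x => ∑' n, condLExp (prodFiltration ℱ n) (Measure.pi P) (f n) x) ≤
        c * mixedNorm P p (fun x => ∑' n, f n x) := by
  have h0 : ∀ i, p i ≠ 0 := fun i => (zero_lt_one.trans_le (h1 i)).ne'
  have hp : ∀ i, 1 ≤ (p i).toReal := fun i => by
    rw [← ENNReal.toReal_one]; exact ENNReal.toReal_mono (htop i) (h1 i)
  have hp1 : ∀ i, (p i).toReal = 1 ↔ p i = 1 := fun i => ENNReal.toReal_eq_one_iff _
  -- Any exponent above 1 would do in place of 2: the full mixed norm is constant and the space has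
  -- mass 1.
  obtain ⟨C, hC⟩ := (exists_sumBound_partialNorm.{u} hp
    (fun i hi j hj => (hp1 j).2 (hlead i ((hp1 i).1 hi) j hj)) d).1 2 one_lt_two
  refine ⟨C ^ (2⁻¹ : ℝ), fun Ω m P _ ℱ f hf => ?_⟩
  obtain ⟨x⟩ := nonempty_of_isProbabilityMeasure (Measure.pi P)
  set a : ℕ → ((i : Fin d) → Ω i) → ℝ≥0∞ := fun n => condLExp (prodFiltration ℱ n) (Measure.pi P) (f n)
  have ha : ∀ n, Measurable (a n) := fun n => measurable_condLExp' _ _ _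
  have hsum : (fun x => ∑' n, a n x) = fun x => ⨆ K, ∑ n ∈ Finset.range K, a n x := by
    funext x; exact ENNReal.tsum_eq_iSup_nat
  rw [hsum, ← partialNorm_eq_mixedNorm P h0 htop _ x, partialNorm_iSup hp
    (fun K => Finset.measurable_fun_sum _ fun n _ => ha n)
    (monotone_nat_of_le_succ fun K y => by simp only [Finset.sum_range_succ]; exact le_self_add)]
  refine iSup_le fun K => ?_
  have hK := hC Ω P ℱ K f hf
  simp only [partialNorm_eq_mixedNorm P h0 htop, lintegral_const, measure_univ, mul_one] at hK ⊢
  calc mixedNorm P p (fun y => ∑ n ∈ Finset.range K, a n y)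
      = (mixedNorm P p (fun y => ∑ n ∈ Finset.range K, a n y) ^ (2 : ℝ)) ^ (2⁻¹ : ℝ) :=
        (ENNReal.rpow_rpow_inv two_ne_zero _).symm
    _ ≤ (C * mixedNorm P p (fun y => ∑ n ∈ Finset.range K, f n y) ^ (2 : ℝ)) ^ (2⁻¹ : ℝ) :=
        ENNReal.rpow_le_rpow hK (by norm_num)
    _ = (C ^ (2⁻¹ : ℝ) : ℝ≥0) * mixedNorm P p (fun y => ∑ n ∈ Finset.range K, f n y) := by
        rw [ENNReal.mul_rpow_of_nonneg _ _ (by norm_num), ENNReal.rpow_rpow_inv two_ne_zero,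
          ENNReal.coe_rpow_of_nonneg _ (by norm_num)]
    _ ≤ _ := by
        refine mul_le_mul' le_rfl ?_
        rw [← partialNorm_eq_mixedNorm P h0 htop _ x, ← partialNorm_eq_mixedNorm P h0 htop _ x]
        exact partialNorm_mono hp (fun y => ENNReal.sum_le_tsum _) d x

theorem exists_mixedNorm_condQuadVar_le {d : ℕ} {p : Fin d → ℝ≥0∞} (h1 : ∀ i, 1 ≤ p i / 2)
    (htop : ∀ i, p i / 2 ≠ ∞) (hlead : ∀ i, p i / 2 = 1 → ∀ j < i, p j / 2 = 1) :
    ∃ c : ℝ≥0, ∀ (Ω : Fin d → Type u) [m : (i : Fin d) → MeasurableSpace (Ω i)]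
      (P : (i : Fin d) → Measure (Ω i)) [∀ i, IsProbabilityMeasure (P i)]
      (ℱ : (i : Fin d) → Filtration ℕ (m i)) (f : ℕ → ((i : Fin d) → Ω i) → ℝ),
      (∀ n, Measurable (f n)) →
      mixedNorm P p (condQuadVar (prodFiltration ℱ) (Measure.pi P) f) ≤
        c * mixedNorm P p (quadVar f) := by
  obtain ⟨c, hc⟩ := exists_mixedNorm_tsum_condLExp_le.{u} h1 htop hlead
  have hp0 : ∀ i, p i ≠ 0 := fun i hi => by simpa [hi] using h1 i
  have hptop : ∀ i, p i ≠ ∞ := fun i hi => by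
    refine htop i ?_
    rw [hi, ENNReal.top_div_of_ne_top (by simp)]
  refine ⟨c ^ (1 / 2 : ℝ), fun Ω m P _ ℱ f hf => ?_⟩
  -- Dropping the zero term d_0 f aligns the index: d_{n+1} f is paired with E_n.
  have hquad : quadVar f = fun x => (∑' n, ‖mdiff f (n + 1) x‖ₑ ^ 2) ^ (1 / 2 : ℝ) := by
    funext x
    rw [quadVar, tsum_eq_zero_add' ENNReal.summable]
    simp [mdiff]
  have hcond : condQuadVar (prodFiltration ℱ) (Measure.pi P) f = fun x =>
      (∑' n, condLExp (prodFiltration ℱ n) (Measure.pi P)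
        (fun y => ‖mdiff f (n + 1) y‖ₑ ^ 2) x) ^ (1 / 2 : ℝ) := rfl
  rw [hquad, hcond, mixedNorm_rpow_half P hp0 hptop, mixedNorm_rpow_half P hp0 hptop,
    ENNReal.coe_rpow_of_nonneg _ (by norm_num), ← ENNReal.mul_rpow_of_nonneg _ _ (by norm_num)]
  refine ENNReal.rpow_le_rpow (hc Ω P ℱ _ fun n => ?_) (by norm_num)
  exact (((hf (n + 1)).sub (hf n)).enorm).pow_const 2

/-- Both alternatives share the only feature the induction needs: exponents equal to 1 precede all
others. -/
theorem exponents_of_finiteAbove_or_leadingOnes {d : ℕ} {p : Fin d → ℝ≥0∞} (h : FiniteAbove 1 p ∨ LeadingOnes p) :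
    (∀ i, 1 ≤ p i) ∧ (∀ i, p i ≠ ∞) ∧ ∀ i, p i = 1 → ∀ j < i, p j = 1 := by
  rcases h with h | ⟨k, -, -, hk⟩
  · exact ⟨fun i => (h i).1.le, fun i => (h i).2.ne, fun i hi => absurd hi (h i).1.ne'⟩
  · refine ⟨fun i => ?_, fun i => ?_, fun i hi j hj => (hk j).1 ?_⟩
    · rcases lt_or_ge (i : ℕ) k with hik | hik
      · exact ((hk i).1 hik).ge
      · exact ((hk i).2 hik).1.le
    · rcases lt_or_ge (i : ℕ) k with hik | hik
      · rw [(hk i).1 hik]; exact ENNReal.one_ne_top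
      · exact ((hk i).2 hik).2.ne
    · by_contra hjk
      have hik : k ≤ (i : ℕ) := (not_lt.1 hjk).trans hj.le
      exact absurd hi ((hk i).2 hik).1.ne'

theorem FiniteAbove.half {d : ℕ} {p : Fin d → ℝ≥0∞} (h : FiniteAbove 2 p) :
    FiniteAbove 1 fun i => p i / 2 := by
  refine fun i => ⟨?_, ENNReal.div_lt_top (h i).2.ne two_ne_zero⟩
  rw [ENNReal.lt_div_iff_mul_lt (by simp) (by simp), one_mul]
  exact (h i).1

end MixedMartingale

end

theorem theorem10 {d : ℕ} (hd : 1 ≤ d) (p : Fin d → ℝ≥0∞) :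
    ((MixedMartingale.FiniteAbove 1 p ∨ MixedMartingale.LeadingOnes p) →
      ∃ c : ℝ≥0, ∀ (Ω : Fin d → Type u) [m : (i : Fin d) → MeasurableSpace (Ω i)]
        (P : (i : Fin d) → Measure (Ω i)) [∀ i, IsProbabilityMeasure (P i)]
        (ℱ : (i : Fin d) → Filtration ℕ (m i)),
        (∀ i, ⨆ n, ℱ i n = m i) →
        ∀ f : ℕ → ((i : Fin d) → Ω i) → ℝ≥0∞, (∀ n, Measurable (f n)) →
          MixedMartingale.mixedNorm P p
              (fun x => ∑' n,
                condLExp (MixedMartingale.prodFiltration ℱ n) (Measure.pi P) (f n) x) ≤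
            c * MixedMartingale.mixedNorm P p (fun x => ∑' n, f n x)) ∧
    ((MixedMartingale.FiniteAbove 2 p ∨ MixedMartingale.LeadingOnes (fun i => p i / 2)) →
      ∃ c : ℝ≥0, ∀ (Ω : Fin d → Type u) [m : (i : Fin d) → MeasurableSpace (Ω i)]
        (P : (i : Fin d) → Measure (Ω i)) [∀ i, IsProbabilityMeasure (P i)]
        (ℱ : (i : Fin d) → Filtration ℕ (m i)),
        (∀ i, ⨆ n, ℱ i n = m i) →
        ∀ f : ℕ → ((i : Fin d) → Ω i) → ℝ,
          Martingale f (MixedMartingale.prodFiltration ℱ) (Measure.pi P) →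
          f 0 =ᵐ[Measure.pi P] 0 →
          MixedMartingale.mixedNorm P p
              (MixedMartingale.condQuadVar (MixedMartingale.prodFiltration ℱ) (Measure.pi P) f) ≤
            c * MixedMartingale.mixedNorm P p (MixedMartingale.quadVar f)) := by
  constructor
  · intro h
    obtain ⟨h1, htop, hlead⟩ := MixedMartingale.exponents_of_finiteAbove_or_leadingOnes h
    obtain ⟨c, hc⟩ := MixedMartingale.exists_mixedNorm_tsum_condLExp_le.{u} h1 htop hlead
    exact ⟨c, fun Ω m P _ ℱ _ f hf => hc Ω P ℱ f hf⟩
  · intro h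
    obtain ⟨h1, htop, hlead⟩ :=
      MixedMartingale.exponents_of_finiteAbove_or_leadingOnes (h.imp_left MixedMartingale.FiniteAbove.half)
    obtain ⟨c, hc⟩ := MixedMartingale.exists_mixedNorm_condQuadVar_le.{u} h1 htop hlead
    refine ⟨c, fun Ω m P _ ℱ _ f hf _ => hc Ω P ℱ f fun n => ?_⟩
    exact ((hf.stronglyAdapted n).mono ((MixedMartingale.prodFiltration ℱ).le n)).measurable
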